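/- Let $n\ge 1$, $s\in(0,1)$, $T>0$, and let $\Omega\subset\mathbb R^n$ be a bounded open set. All functions are real valued. Let $H^s(\mathbb R^n)=\{v\in L^2(\mathbb R^n): (1+|\xi|^2)^{s/2}\mathcal F v\in L^2(\mathbb R^n)\}$, normed by $\|(1+|\xi|^2)^{s/2}\mathcal F v\|_{L^2}$, let $\tilde H^s(\Omega)$ be the closure of $C_0^\infty(\Omega)$ in $H^s(\mathbb R^n)$, and let $H^{-s}(\Omega)$ be its dual. Put $$|v|_{H^s(\mathbb R^n)}^2=\iint_{\mathbb R^n\times\mathbb R^n}\frac{|v(x)-v(y)|^2}{|x-y|^{n+2s}}\,dx\,dy,\qquad \mathcal A(v,w)=\frac{C(n,s)}2\iint_{\mathbb R^n\times\mathbb R^n}\frac{(v(x)-v(y))(w(x)-w(y))}{|x-y|^{n+2s}}\,dx\,dy,$$ where $C(n,s)=\dfrac{2^{2s}s\,\Gamma(s+n/2)}{\pi^{n/2}\Gamma(1-s)}$. Then there is a constant $C>0$ (it may depend on $n,s,\Omega,T$, but not on $\mathcal K$, $u_0$, $f$, $u$, $U^\tau$) such that the following holds for every integer $\mathcal K\ge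 1$, with $\tau=T/\mathcal K$ and $t_k=k\tau$, and for all $u_0\in\tilde H^s(\Omega)$ and $f\in L^\infty(0,T;L^2(\Omega))$. Let $u\in L^2(0,T;\tilde H^s(\Omega))\cap L^\infty(0,T;L^2(\Omega))$ with $\partial_t u\in L^2(0,T;H^{-s}(\Omega))$ be the weak solution of the fractional heat equation $\partial_t u+(-\Delta)^s u=f$ in $\Omega\times(0,T)$, $u=0$ in $(\mathbb R^n\setminus\Omega)\times(0,T)$, with initial datum $u_0$; that is, $u(0)=u_0$ (for the representative of $u$ in $C([0,T];L^2(\Omega))$) and, for a.e. $t\in(0,T)$, $$\langle\partial_t u(t),\phi\rangle+\mathcal A(u(t),\phi)=(f(t),\phi)_{L^2(\Omega)}\qquad\forall\phi\in\tilde H^s(\Omega).$$ Let $U^0,\dots,U^{\mathcal K}\in\tilde H^s(\Omega)$ be the solution of the backward Euler scheme: $U^0=u_0$ and, for $k=0,\dots,\mathcal K-1$, $$\Big(\frac{U^{k+1}-U^k}{\tau},\phi\Big)_{L^2(\Omega)}+\mathcal A(U^{k+1},\phi)=(f^{k+1},\phi)_{L^2(\Omega)}\quad\forall\phi\in\tilde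 H^s(\Omega),\qquad f^{k+1}=\frac1\tau\int_{t_k}^{t_{k+1}}f\,dt,$$ and let $U^\tau$ be the function of time equal to $U^k$ on $(t_{k-1},t_k]$, $k=1,\dots,\mathcal K$. Then $$\|u-U^\tau\|_{L^2(0,T;L^2(\Omega))}\le C\,\tau\left(|u_0|_{H^s(\mathbb R^n)}+\|f\|_{L^\infty(0,T;L^2(\Omega))}\right).$$ -/

import Mathlib

open MeasureTheory Filter Topology
open scoped ENNReal ContDiff FourierTransform

noncomputable section

namespace FracHeat

/-- Euclidean space `ℝⁿ`. -/
abbrev Eucl (n : ℕ) : Type := EuclideanSpace ℝ (Fin n)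

/-- Real-valued `L²(ℝⁿ)`. -/
abbrev L2Space (n : ℕ) : Type := Lp ℝ 2 (volume : Measure (Eucl n))

/-- Real-valued `L²(Ω)`. -/
abbrev L2On {n : ℕ} (Ω : Set (Eucl n)) : Type := Lp ℝ 2 ((volume : Measure (Eucl n)).restrict Ω)

/-! ### Sobolev spaces -/

/-- The `L²` Fourier transform of a real-valued function `v ∈ L²(ℝⁿ)`. -/
def fourierL2 {n : ℕ} (v : L2Space n) : Lp ℂ 2 (volume : Measure (Eucl n)) :=
  𝓕 (Complex.ofRealCLM.compLpL 2 volume v : Lp ℂ 2 (volume : Measure (Eucl n)))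

lemma fourierL2_add {n : ℕ} (v w : L2Space n) :
    fourierL2 (v + w) = fourierL2 v + fourierL2 w := by
  unfold fourierL2
  rw [map_add]
  exact map_add (Lp.fourierTransformₗᵢ (Eucl n) ℂ) _ _

lemma fourierL2_smul {n : ℕ} (c : ℝ) (v : L2Space n) :
    fourierL2 (c • v) = c • fourierL2 v := by
  unfold fourierL2
  rw [map_smul]
  exact LinearMap.map_smul_of_tower (Lp.fourierTransformₗᵢ (Eucl n) ℂ).toLinearEquiv.toLinearMap
    c _

/-- The function `ξ ↦ (1 + |ξ|²)^(s/2) 𝓕v(ξ)`. -/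
def weightedFourier {n : ℕ} (s : ℝ) (v : L2Space n) (ξ : Eucl n) : ℂ :=
  ((1 + ‖ξ‖ ^ 2) ^ (s / 2) : ℝ) • fourierL2 v ξ

lemma weightedFourier_add {n : ℕ} (s : ℝ) (v w : L2Space n) :
    weightedFourier s (v + w) =ᵐ[volume] weightedFourier s v + weightedFourier s w := by
  filter_upwards [Lp.coeFn_add (fourierL2 v) (fourierL2 w)] with ξ hξ
  simp only [weightedFourier, fourierL2_add, Pi.add_apply, hξ, smul_add]

lemma weightedFourier_smul {n : ℕ} (s c : ℝ) (v : L2Space n) :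
    weightedFourier s (c • v) =ᵐ[volume] c • weightedFourier s v := by
  filter_upwards [Lp.coeFn_smul c (fourierL2 v)] with ξ hξ
  simp only [weightedFourier, fourierL2_smul, Pi.smul_apply, hξ]
  rw [smul_comm]

/-- The real-valued Sobolev space `Hˢ(ℝⁿ)` as a set of `L²` functions:
all `v ∈ L²(ℝⁿ)` with `(1 + |ξ|²)^(s/2) 𝓕v ∈ L²(ℝⁿ)`. -/
def sobolevSubmodule (n : ℕ) (s : ℝ) : Submodule ℝ (L2Space n) where
  carrier := {v | MemLp (weightedFourier s v) 2 volume}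
  zero_mem' := by
    have h := weightedFourier_smul s 0 (0 : L2Space n)
    rw [zero_smul, zero_smul] at h
    exact MemLp.ae_eq h.symm MemLp.zero
  add_mem' := fun {v w} hv hw => MemLp.ae_eq (weightedFourier_add s v w).symm (hv.add hw)
  smul_mem' := fun c v hv => MemLp.ae_eq (weightedFourier_smul s c v).symm (hv.const_smul c)

/-- The map `v ↦ (1 + |ξ|²)^(s/2) 𝓕v` from `Hˢ(ℝⁿ)` to `L²(ℝⁿ; ℂ)`. -/
def besselMap (n : ℕ) (s : ℝ) :
    sobolevSubmodule n s →ₗ[ℝ] Lp ℂ 2 (volume : Measure (Eucl n)) where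
  toFun v := MemLp.toLp (weightedFourier s v.1) v.2
  map_add' v w := by
    have h1 : MemLp (weightedFourier s v.1) 2 volume := v.2
    have h2 : MemLp (weightedFourier s w.1) 2 volume := w.2
    have h3 : MemLp (weightedFourier s (v.1 + w.1)) 2 volume := (v + w).2
    change MemLp.toLp (weightedFourier s (v.1 + w.1)) h3 = h1.toLp _ + h2.toLp _
    rw [← MemLp.toLp_add h1 h2]
    exact MemLp.toLp_congr _ _ (weightedFourier_add s v.1 w.1)
  map_smul' c v := by
    have h1 : MemLp (weightedFourier s v.1) 2 volume := v.2
    have h3 : MemLp (weightedFourier s (c • v.1)) 2 volume := (c • v).2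
    change MemLp.toLp (weightedFourier s (c • v.1)) h3 = c • h1.toLp _
    rw [← MemLp.toLp_const_smul c h1]
    exact MemLp.toLp_congr _ _ (weightedFourier_smul s c v.1)

lemma besselMap_injective (n : ℕ) (s : ℝ) : Function.Injective (besselMap n s) := by
  rw [injective_iff_map_eq_zero]
  intro v hv
  have h0 : weightedFourier s v.1 =ᵐ[volume] 0 := by
    have h1 := MemLp.coeFn_toLp v.2
    have h2 : MemLp.toLp (weightedFourier s v.1) v.2 = 0 := hv
    rw [h2] at h1
    exact h1.symm.trans (Lp.coeFn_zero _ _ _)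
  have h3 : fourierL2 v.1 = 0 := by
    rw [Lp.eq_zero_iff_ae_eq_zero]
    filter_upwards [h0] with ξ hξ
    have hpos : (0 : ℝ) < (1 + ‖ξ‖ ^ 2) ^ (s / 2) := by positivity
    exact (smul_eq_zero.mp hξ).resolve_left hpos.ne'
  have h4 : Complex.ofRealCLM.compLpL 2 (volume : Measure (Eucl n)) v.1 = 0 :=
    (map_eq_zero_iff (Lp.fourierTransformₗᵢ (Eucl n) ℂ)
      (Lp.fourierTransformₗᵢ (Eucl n) ℂ).injective).mp h3
  have h5 : (v.1 : L2Space n) = 0 := by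
    rw [Lp.eq_zero_iff_ae_eq_zero]
    have h6 := Complex.ofRealCLM.coeFn_compLpL v.1
    rw [h4] at h6
    filter_upwards [h6, Lp.coeFn_zero ℂ 2 (volume : Measure (Eucl n))] with x hx hx0
    rw [hx0] at hx
    simpa using hx.symm
  exact Subtype.ext h5

/-- The Sobolev space `Hˢ(ℝⁿ)`, as a type of its own carrying its own norm (below). -/
def Hs (n : ℕ) (s : ℝ) : Type := sobolevSubmodule n s

instance (n : ℕ) (s : ℝ) : AddCommGroup (Hs n s) :=
  inferInstanceAs (AddCommGroup (sobolevSubmodule n s))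

instance (n : ℕ) (s : ℝ) : Module ℝ (Hs n s) :=
  inferInstanceAs (Module ℝ (sobolevSubmodule n s))

/-- The inclusion `Hˢ(ℝⁿ) → L²(ℝⁿ)`. -/
def Hs.toL2 (n : ℕ) (s : ℝ) : Hs n s →ₗ[ℝ] L2Space n := (sobolevSubmodule n s).subtype

/-- The map `besselMap` on the type `Hs n s`. -/
def Hs.bessel (n : ℕ) (s : ℝ) : Hs n s →ₗ[ℝ] Lp ℂ 2 (volume : Measure (Eucl n)) :=
  besselMap n s

lemma Hs.bessel_injective (n : ℕ) (s : ℝ) : Function.Injective (Hs.bessel n s) :=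
  besselMap_injective n s

/-- The norm of `Hˢ(ℝⁿ)`: `‖v‖ = ‖(1 + |ξ|²)^(s/2) 𝓕v‖_{L²}`. -/
instance (n : ℕ) (s : ℝ) : NormedAddCommGroup (Hs n s) :=
  NormedAddCommGroup.induced _ _ (Hs.bessel n s) (Hs.bessel_injective n s)

instance (n : ℕ) (s : ℝ) : NormedSpace ℝ (Hs n s) :=
  NormedSpace.induced ℝ (Hs n s) (Lp ℂ 2 (volume : Measure (Eucl n))) (Hs.bessel n s)

/-- The elements of `Hˢ(ℝⁿ)` that are (represented by) functions in `C₀^∞(Ω)`. -/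
def testFunctions (n : ℕ) (s : ℝ) (Ω : Set (Eucl n)) : Submodule ℝ (Hs n s) where
  carrier := {v | ∃ φ : Eucl n → ℝ, ContDiff ℝ ∞ φ ∧ HasCompactSupport φ ∧ tsupport φ ⊆ Ω ∧
    Hs.toL2 n s v =ᵐ[volume] φ}
  zero_mem' := by
    refine ⟨0, contDiff_const, HasCompactSupport.zero, by simp [tsupport], ?_⟩
    rw [map_zero]
    exact Lp.coeFn_zero _ _ _
  add_mem' := by
    rintro v w ⟨φ, h1, h2, h3, h4⟩ ⟨ψ, k1, k2, k3, k4⟩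
    refine ⟨φ + ψ, h1.add k1, h2.add k2,
      (tsupport_add φ ψ).trans (Set.union_subset h3 k3), ?_⟩
    rw [map_add]
    exact (Lp.coeFn_add _ _).trans (h4.add k4)
  smul_mem' := by
    rintro c v ⟨φ, h1, h2, h3, h4⟩
    refine ⟨c • φ, contDiff_const.smul h1, h2.smul_left (f := fun _ => c),
      (tsupport_smul_subset_right (fun _ => c) φ).trans h3, ?_⟩
    rw [map_smul]
    exact (Lp.coeFn_smul _ _).trans (h4.const_smul c)

/-- `H̃ˢ(Ω)`: the closure of `C₀^∞(Ω)` in `Hˢ(ℝⁿ)`, with the norm of `Hˢ(ℝⁿ)`. -/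
def HsTilde (n : ℕ) (s : ℝ) (Ω : Set (Eucl n)) : Submodule ℝ (Hs n s) :=
  (testFunctions n s Ω).topologicalClosure

/-- `H⁻ˢ(Ω)`: the dual space of `H̃ˢ(Ω)`. -/
abbrev HsNeg (n : ℕ) (s : ℝ) (Ω : Set (Eucl n)) : Type := StrongDual ℝ (HsTilde n s Ω)

variable {n : ℕ} {s : ℝ} {Ω : Set (Eucl n)}

/-- An element of `H̃ˢ(Ω)` as a function on `ℝⁿ` (up to null sets). -/
def toFun (v : HsTilde n s Ω) : Eucl n → ℝ := Hs.toL2 n s v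

/-- An element of `H̃ˢ(Ω)` as an element of `L²(Ω)`, by restriction to `Ω`. -/
def toL2On : HsTilde n s Ω →ₗ[ℝ] L2On Ω :=
  (LpToLpRestrictCLM (Eucl n) ℝ ℝ volume 2 Ω).toLinearMap ∘ₗ Hs.toL2 n s ∘ₗ
    (HsTilde n s Ω).subtype

/-! ### The energy form of the integral fractional Laplacian -/

/-- `C(n,s) = 2^(2s) s Γ(s + n/2) / (π^(n/2) Γ(1 - s))`. -/
def fracConst (n : ℕ) (s : ℝ) : ℝ :=
  2 ^ (2 * s) * s * Real.Gamma (s + n / 2) / (Real.pi ^ ((n : ℝ) / 2) * Real.Gamma (1 - s))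

/-- `𝒜(v,w) = C(n,s)/2 ∬ (v(x) - v(y)) (w(x) - w(y)) / |x - y|^(n+2s) dx dy`. -/
def energyForm (v w : HsTilde n s Ω) : ℝ :=
  fracConst n s / 2 * ∫ p : Eucl n × Eucl n,
    (toFun v p.1 - toFun v p.2) * (toFun w p.1 - toFun w p.2) / ‖p.1 - p.2‖ ^ ((n : ℝ) + 2 * s)

/-- The seminorm `|v|_{Hˢ(ℝⁿ)} = (∬ |v(x) - v(y)|² / |x - y|^(n+2s) dx dy)^(1/2)`. -/
def sobolevSeminorm (v : HsTilde n s Ω) : ℝ :=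
  Real.sqrt (∫ p : Eucl n × Eucl n,
    (toFun v p.1 - toFun v p.2) ^ 2 / ‖p.1 - p.2‖ ^ ((n : ℝ) + 2 * s))

/-! ### The fractional heat equation -/

/-- Lebesgue measure on the time interval `(0,T)`; thus `MemLp u p (timeMeasure T)` for
`u : ℝ → X` says that `u ∈ L^p(0,T;X)`, and `eLpNorm u p (timeMeasure T)` is its norm. -/
def timeMeasure (T : ℝ) : Measure ℝ := (volume : Measure ℝ).restrict (Set.Ioo 0 T)

/-- `g : (0,T) → H⁻ˢ(Ω)` is the weak time derivative of `u : (0,T) → H̃ˢ(Ω)`, with respect to the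
embeddings `H̃ˢ(Ω) ⊂ L²(Ω) ⊂ H⁻ˢ(Ω)`: for all `η ∈ C₀^∞(0,T)` and all `φ ∈ H̃ˢ(Ω)`,
`∫₀ᵀ η'(t) (u(t), φ)_{L²(Ω)} dt = - ∫₀ᵀ η(t) ⟨g(t), φ⟩ dt`. -/
def IsWeakTimeDeriv (T : ℝ) (u : ℝ → HsTilde n s Ω) (g : ℝ → HsNeg n s Ω) : Prop :=
  ∀ η : ℝ → ℝ, ContDiff ℝ ∞ η → HasCompactSupport η → tsupport η ⊆ Set.Ioo 0 T →
    ∀ φ : HsTilde n s Ω,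
      ∫ t, deriv η t * inner ℝ (toL2On (u t)) (toL2On φ) ∂(timeMeasure T) =
        - ∫ t, η t * g t φ ∂(timeMeasure T)

/-- `u` is a weak solution of `∂ₜu + (-Δ)ˢ u = f` in `Ω × (0,T)`, `u = 0` in `Ωᶜ × (0,T)`,
`u(0) = u₀`, for `f : (0,T) → L²(Ω)` and `u₀ ∈ L²(Ω)`:
`u ∈ L²(0,T;H̃ˢ(Ω)) ∩ L^∞(0,T;L²(Ω))` has a weak time derivative in `L²(0,T;H⁻ˢ(Ω))`; for a.e. `t`,
`⟨∂ₜu, φ⟩ + 𝒜(u, φ) = (f, φ)_{L²(Ω)}` for all `φ ∈ H̃ˢ(Ω)`; and `u(0) = u₀`, i.e. the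
representative of `u` in `C([0,T];L²(Ω))` takes the value `u₀` at `0`. -/
def IsWeakSolution (T : ℝ) (f : ℝ → L2On Ω) (u₀ : L2On Ω) (u : ℝ → HsTilde n s Ω) : Prop :=
  MemLp u 2 (timeMeasure T) ∧
  MemLp (fun t => toL2On (u t)) ∞ (timeMeasure T) ∧
  (∃ g : ℝ → HsNeg n s Ω, MemLp g 2 (timeMeasure T) ∧ IsWeakTimeDeriv T u g ∧
    ∀ᵐ t ∂(timeMeasure T), ∀ φ : HsTilde n s Ω,
      g t φ + energyForm (u t) φ = inner ℝ (f t) (toL2On φ)) ∧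
  ∃ w : ℝ → L2On Ω, ContinuousOn w (Set.Icc 0 T) ∧
    (∀ᵐ t ∂(timeMeasure T), w t = toL2On (u t)) ∧ w 0 = u₀

/-! ### The backward Euler semidiscretization -/

/-- The average `τ⁻¹ ∫_{kτ}^{(k+1)τ} f dt` of `f` over the time step number `k + 1`. -/
def timeAverage (τ : ℝ) (f : ℝ → L2On Ω) (k : ℕ) : L2On Ω :=
  τ⁻¹ • ∫ t in (k * τ)..((k + 1) * τ), f t

/-- `U⁰, …, U^K` solves the backward Euler scheme with `K` steps of size `τ`: `U⁰ = u₀` and, for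
`0 ≤ k < K`, `((U^{k+1} - U^k)/τ, φ)_{L²(Ω)} + 𝒜(U^{k+1}, φ) = (f^{k+1}, φ)_{L²(Ω)}` for all
`φ ∈ H̃ˢ(Ω)`, where `f^{k+1}` is the average of `f` over `(kτ, (k+1)τ)`. The values `U^k` with
`k > K` are irrelevant. -/
def IsSemidiscreteSolution (K : ℕ) (τ : ℝ) (f : ℝ → L2On Ω) (u₀ : HsTilde n s Ω)
    (U : ℕ → HsTilde n s Ω) : Prop :=
  U 0 = u₀ ∧ ∀ k < K, ∀ φ : HsTilde n s Ω,
    inner ℝ (toL2On (τ⁻¹ • (U (k + 1) - U k))) (toL2On φ) + energyForm (U (k + 1)) φ =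
      inner ℝ (timeAverage τ f k) (toL2On φ)

/-- The piecewise constant function of time `U^τ` with value `U^k` on `((k-1)τ, kτ]`. -/
def piecewiseConst (τ : ℝ) (U : ℕ → HsTilde n s Ω) (t : ℝ) : HsTilde n s Ω := U ⌈t / τ⌉₊

end FracHeat

end

noncomputable section

namespace FracHeat

/-! The equation is treated as an abstract problem `∂ₜ(ι u) + A*A u = f`, with `ι : V → H` the
embedding of `H̃ˢ(Ω)` into `L²(Ω)` and `⟪A v, A w⟫` the energy form. No regularity theory for `u`
enters: `u` is replaced by Euler solutions `Z` on finer and finer grids.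

The central tool is a duality estimate (`sum_norm_sq_le_of_integrated`). Two solutions with the same
data satisfy the same time-integrated equation, so the nodal error `e` and the error `d` of the
averages are linked through the time-integrated error `E`. Testing with `d`, whose multiples are the
increments of `E`, gives `∑ ⟪e, ι d⟫ ≤ 0`, hence `∑ ‖ι d‖² ≤ ∑ ‖ι d - e‖²`. In `ι d - e` one of the
two solutions cancels, leaving only the oscillation of the other within a time step.

The estimate is used twice. Between `U` (step `τ`) and `Z` (step `σ = τ/N`), the oscillation of `Z`
is bounded by the discrete energy estimate `IsEuler.sum_norm_sub_sq_le`, giving an error of order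
`τ` uniformly in `N` (`IsEuler.sum_refinement_le`). Between `u` and `Z`, the oscillation of the
continuous representative of `u` is merely small for small `σ`
(`IsEuler.eLpNorm_sub_le_of_modulus`). Letting `N → ∞` yields the bound (`IsEuler.eLpNorm_sub_le`).

The fine schemes must be solvable, which requires coercivity. By Plancherel the Gagliardo seminorm
has Fourier symbol `c|ξ|^(2s)` with `c > 0`, so together with the `L²` norm it controls the norm of
`Hˢ` (`exists_gagliardoMap`), and Lax–Milgram applies. -/

lemma Lp_enorm_sq {α E : Type*} [MeasurableSpace α] {μ : Measure α} [NormedAddCommGroup E]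
    (w : Lp E 2 μ) : ‖w‖ₑ ^ 2 = ∫⁻ x, ‖w x‖ₑ ^ 2 ∂μ := by
  rw [Lp.enorm_def, eLpNorm_eq_lintegral_rpow_enorm_toReal (by simp) (by simp)]
  simp only [ENNReal.toReal_ofNat, one_div]
  rw [← ENNReal.rpow_natCast, ← ENNReal.rpow_mul]
  norm_num

/-! ### The Fourier transform of a translate -/

section Translation

variable {n : ℕ}

lemma memLp_modulation (h : Eucl n) (v : Lp ℂ 2 (volume : Measure (Eucl n))) :
    MemLp (fun ξ => Real.fourierChar (-inner ℝ h ξ) • v ξ) 2 volume :=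
  (memLp_congr_norm (Lp.aestronglyMeasurable v)
    ((by fun_prop : Continuous fun ξ : Eucl n => Real.fourierChar (-inner ℝ h ξ))
      |>.aestronglyMeasurable.smul (Lp.aestronglyMeasurable v))
    (Eventually.of_forall fun ξ => (Circle.norm_smul _ _).symm)).mp (Lp.memLp v)

/-- Multiplication of an `L²` function by the character `ξ ↦ 𝐞(-⟪h, ξ⟫)`, as an isometry. -/
def modulation (h : Eucl n) :
    Lp ℂ 2 (volume : Measure (Eucl n)) →ₗᵢ[ℂ] Lp ℂ 2 (volume : Measure (Eucl n)) where
  toFun v := (memLp_modulation h v).toLp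
  map_add' v w := by
    rw [← MemLp.toLp_add]
    refine MemLp.toLp_congr _ _ ?_
    filter_upwards [Lp.coeFn_add v w] with ξ hξ
    rw [hξ, Pi.add_apply, smul_add, Pi.add_apply]
  map_smul' c v := by
    rw [RingHom.id_apply, ← MemLp.toLp_const_smul]
    refine MemLp.toLp_congr _ _ ?_
    filter_upwards [Lp.coeFn_smul c v] with ξ hξ
    rw [hξ, Pi.smul_apply, Pi.smul_apply, smul_comm]
  norm_map' v := by
    simp only [LinearMap.coe_mk, AddHom.coe_mk, Lp.norm_toLp]
    rw [Lp.norm_def]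
    congr 1
    exact eLpNorm_congr_norm_ae (Eventually.of_forall fun ξ => Circle.norm_smul _ _)

lemma coeFn_modulation (h : Eucl n) (v : Lp ℂ 2 (volume : Measure (Eucl n))) :
    modulation h v =ᵐ[volume] fun ξ => Real.fourierChar (-inner ℝ h ξ) • v ξ :=
  (memLp_modulation h v).coeFn_toLp

/-- Translation of an `L²` function, as an isometry. -/
def translation (h : Eucl n) :
    Lp ℂ 2 (volume : Measure (Eucl n)) →ₗᵢ[ℂ] Lp ℂ 2 (volume : Measure (Eucl n)) :=
  Lp.compMeasurePreservingₗᵢ ℂ (fun x => x - h) (measurePreserving_sub_right volume h)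

lemma coeFn_translation (h : Eucl n) (v : Lp ℂ 2 (volume : Measure (Eucl n))) :
    translation h v =ᵐ[volume] fun x => v (x - h) :=
  Lp.coeFn_compMeasurePreserving v (measurePreserving_sub_right volume h)

lemma fourier_compSubConst (h : Eucl n) (φ : SchwartzMap (Eucl n) ℂ) (ξ : Eucl n) :
    𝓕 (SchwartzMap.compSubConstCLM ℂ h φ) ξ =
      Real.fourierChar (-inner ℝ h ξ) • 𝓕 φ ξ := by
  rw [SchwartzMap.fourier_coe, SchwartzMap.fourier_coe]
  have := congrFun (VectorFourier.fourierIntegral_comp_add_right Real.fourierChar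
    (volume : Measure (Eucl n)) (innerₗ (Eucl n)) φ (-h)) ξ
  simp only [map_neg, LinearMap.neg_apply, innerₗ_apply_apply] at this
  exact this

/-- Both sides are continuous in `v`, so it suffices to take Schwartz functions, where the claim is
a change of variables in the Fourier integral. -/
theorem fourier_translation (h : Eucl n) (v : Lp ℂ 2 (volume : Measure (Eucl n))) :
    𝓕 (translation h v) = modulation h (𝓕 v) := by
  refine DenseRange.induction_on (p := fun v => 𝓕 (translation h v) = modulation h (𝓕 v))
    (SchwartzMap.denseRange_toLpCLM (F := ℂ) (p := 2) (μ := volume) ENNReal.ofNat_ne_top) v ?_ ?_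
  · have hF : Continuous (fun v : Lp ℂ 2 (volume : Measure (Eucl n)) => 𝓕 v) :=
      (Lp.fourierTransformₗᵢ (Eucl n) ℂ).continuous
    exact isClosed_eq (hF.comp (translation h).continuous) ((modulation h).continuous.comp hF)
  · intro φ
    have h1 : translation h (φ.toLp 2) = (SchwartzMap.compSubConstCLM ℂ h φ).toLp 2 := by
      apply Lp.ext
      have h2 := (measurePreserving_sub_right volume h).quasiMeasurePreserving.ae_eq_comp
        (φ.coeFn_toLp 2)
      filter_upwards [coeFn_translation h (φ.toLp 2), h2,
        (SchwartzMap.compSubConstCLM ℂ h φ).coeFn_toLp 2] with x h3 h4 h5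
      rw [h3, h5]
      exact h4
    simp only [SchwartzMap.toLpCLM_apply]
    rw [h1, SchwartzMap.toLp_fourier_eq, SchwartzMap.toLp_fourier_eq]
    apply Lp.ext
    filter_upwards [coeFn_modulation h ((𝓕 φ).toLp 2), (𝓕 φ).coeFn_toLp 2,
      (𝓕 (SchwartzMap.compSubConstCLM ℂ h φ)).coeFn_toLp 2] with x h3 h4 h5
    rw [h3, h4, h5, fourier_compSubConst]

/-- The multiplier `|𝐞(-⟪h, ξ⟫) - 1|²` of a difference. -/
def diffSymbol (h ξ : Eucl n) : ℝ≥0∞ :=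
  ‖(Real.fourierChar (-inner ℝ h ξ) : ℂ) - 1‖ₑ ^ 2

/-- Plancherel for the complexification of `v`: translation becomes multiplication by a character.
-/
theorem lintegral_diff_sq (h : Eucl n) (v : L2Space n) :
    ∫⁻ x, ‖v (x - h) - v x‖ₑ ^ 2 = ∫⁻ ξ, diffSymbol h ξ * ‖fourierL2 v ξ‖ₑ ^ 2 := by
  set V : Lp ℂ 2 (volume : Measure (Eucl n)) := Complex.ofRealCLM.compLpL 2 volume v with hV
  have hVv : V =ᵐ[volume] fun x => (v x : ℂ) := Complex.ofRealCLM.coeFn_compLpL v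
  have e1 : ∫⁻ x, ‖v (x - h) - v x‖ₑ ^ 2 = ‖translation h V - V‖ₑ ^ 2 := by
    rw [Lp_enorm_sq]
    apply lintegral_congr_ae
    have h2 := (measurePreserving_sub_right volume h).quasiMeasurePreserving.ae_eq_comp hVv
    filter_upwards [Lp.coeFn_sub (translation h V) V, coeFn_translation h V, hVv, h2]
      with x h3 h4 h5 h6
    rw [h3, Pi.sub_apply, h4, h5]
    simp only [Function.comp_apply] at h6
    rw [h6, ← Complex.ofReal_sub, ← ofReal_norm, ← ofReal_norm,
      Complex.norm_real]
  have e2 : ‖translation h V - V‖ₑ = ‖modulation h (𝓕 V) - 𝓕 V‖ₑ := by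
    rw [← fourier_translation, ← ofReal_norm, ← ofReal_norm]
    congr 1
    rw [← Lp.norm_fourier_eq]
    congr 1
    exact map_sub (Lp.fourierTransformₗᵢ (Eucl n) ℂ) _ _
  rw [e1, e2, Lp_enorm_sq]
  apply lintegral_congr_ae
  filter_upwards [Lp.coeFn_sub (modulation h (𝓕 V)) (𝓕 V), coeFn_modulation h (𝓕 V)] with ξ h3 h4
  rw [h3, Pi.sub_apply, h4, diffSymbol, ← mul_pow, ← enorm_mul, sub_mul, one_mul]
  rfl

end Translation

/-! ### The Fourier symbol of the Gagliardo seminorm -/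

section Symbol

variable {n : ℕ}

/-- The kernel `|h|^(-n-2s)`. -/
def gagliardoKernel (s : ℝ) (h : Eucl n) : ℝ≥0∞ :=
  ENNReal.ofReal (‖h‖ ^ ((n : ℝ) + 2 * s))⁻¹

@[fun_prop]
lemma measurable_gagliardoKernel (s : ℝ) :
    Measurable (gagliardoKernel s : Eucl n → ℝ≥0∞) := by
  unfold gagliardoKernel
  fun_prop

@[fun_prop]
lemma measurable_diffSymbol :
    Measurable (fun p : Eucl n × Eucl n => diffSymbol p.1 p.2) := by
  unfold diffSymbol
  exact ((by fun_prop : Continuous fun p : Eucl n × Eucl n =>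
    (Real.fourierChar (-inner ℝ p.1 p.2) : ℂ) - 1).measurable.enorm).pow_const 2

/-- The Fourier symbol `∫ |𝐞(-⟪h, ξ⟫) - 1|² |h|^(-n-2s) dh` of the Gagliardo seminorm. -/
def gagliardoSymbol (s : ℝ) (ξ : Eucl n) : ℝ≥0∞ :=
  ∫⁻ h, diffSymbol h ξ * gagliardoKernel s h

/-- Substitute `y = x - h`, apply Plancherel in `x` for each fixed `h`, and integrate over `h` last
to form the symbol. Everything is valued in `ℝ≥0∞`, so Tonelli needs no finiteness of the seminorm.
-/
theorem lintegral_gagliardo (s : ℝ) (v : L2Space n) :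
    ∫⁻ p : Eucl n × Eucl n, ‖v p.1 - v p.2‖ₑ ^ 2 * gagliardoKernel s (p.1 - p.2) =
      ∫⁻ ξ, gagliardoSymbol s ξ * ‖fourierL2 v ξ‖ₑ ^ 2 := by
  have hv : Measurable (v : Eucl n → ℝ) := (Lp.stronglyMeasurable v).measurable
  have hF : Measurable (fourierL2 v : Eucl n → ℂ) := (Lp.stronglyMeasurable _).measurable
  calc ∫⁻ p : Eucl n × Eucl n, ‖v p.1 - v p.2‖ₑ ^ 2 * gagliardoKernel s (p.1 - p.2)
      = ∫⁻ x, ∫⁻ y, ‖v x - v y‖ₑ ^ 2 * gagliardoKernel s (x - y) := by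
        rw [Measure.volume_eq_prod, lintegral_prod]
        fun_prop
    _ = ∫⁻ x, ∫⁻ h, ‖v (x - h) - v x‖ₑ ^ 2 * gagliardoKernel s h := by
        refine lintegral_congr fun x => ?_
        rw [← lintegral_sub_left_eq_self
          (fun y => ‖v x - v y‖ₑ ^ 2 * gagliardoKernel s (x - y)) x]
        refine lintegral_congr fun h => ?_
        rw [sub_sub_cancel, enorm_sub_rev]
    _ = ∫⁻ h, ∫⁻ x, ‖v (x - h) - v x‖ₑ ^ 2 * gagliardoKernel s h := by
        rw [lintegral_lintegral_swap]
        unfold Function.uncurry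
        fun_prop
    _ = ∫⁻ h, ∫⁻ ξ, diffSymbol h ξ * ‖fourierL2 v ξ‖ₑ ^ 2 * gagliardoKernel s h := by
        refine lintegral_congr fun h => ?_
        rw [lintegral_mul_const _ (by fun_prop), lintegral_diff_sq, lintegral_mul_const]
        exact (measurable_diffSymbol.comp (measurable_const.prodMk measurable_id)).mul (by fun_prop)
    _ = ∫⁻ ξ, ∫⁻ h, diffSymbol h ξ * ‖fourierL2 v ξ‖ₑ ^ 2 * gagliardoKernel s h := by
        rw [lintegral_lintegral_swap]
        unfold Function.uncurry
        fun_prop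
    _ = _ := by
        refine lintegral_congr fun ξ => ?_
        rw [gagliardoSymbol, ← lintegral_mul_const]
        · simp_rw [mul_right_comm]
        · exact (measurable_diffSymbol.comp (measurable_id.prodMk measurable_const)).mul
            (by fun_prop)

lemma lintegral_comp_smul_eucl {f : Eucl n → ℝ≥0∞} (hf : Measurable f) {r : ℝ} (hr : 0 < r) :
    ∫⁻ h, f (r • h) = ENNReal.ofReal (r ^ n)⁻¹ * ∫⁻ h, f h := by
  rw [← lintegral_map (μ := volume) (g := fun h : Eucl n => r • h) hf (by fun_prop)]
  have := Measure.map_addHaar_smul (volume : Measure (Eucl n)) hr.ne'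
  rw [this, lintegral_smul_measure, smul_eq_mul, finrank_euclideanSpace, Fintype.card_fin,
    abs_of_pos (by positivity)]

/-- Invariance under rotation and scaling: replacing `h` by `r • R h` yields `r^(n+2s)` from the
kernel and `r^(-n)` from Lebesgue measure. -/
theorem gagliardoSymbol_eq {s : ℝ} (e : Eucl n) (he : ‖e‖ = 1) {ξ : Eucl n} (hξ : ξ ≠ 0) :
    gagliardoSymbol s ξ = ENNReal.ofReal (‖ξ‖ ^ (2 * s)) * gagliardoSymbol s e := by
  set r := ‖ξ‖ with hr
  have hr0 : 0 < r := norm_pos_iff.mpr hξ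
  -- Two vectors of equal norm are exchanged by the reflection in the hyperplane orthogonal to their
  -- difference.
  obtain ⟨R, hR⟩ : ∃ R : Eucl n ≃ₗᵢ[ℝ] Eucl n, R ξ = r • e :=
    ⟨_, Submodule.reflection_sub (by rw [norm_smul, he, Real.norm_of_nonneg hr0.le, mul_one])⟩
  have hmeas : Measurable fun h : Eucl n => diffSymbol h e * gagliardoKernel s h :=
    (measurable_diffSymbol.comp (measurable_id.prodMk measurable_const)).mul (by fun_prop)
  have h1 : ∀ h : Eucl n, diffSymbol h ξ * gagliardoKernel s h =
      ENNReal.ofReal (r ^ ((n : ℝ) + 2 * s)) *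
        (diffSymbol (r • R h) e * gagliardoKernel s (r • R h)) := by
    intro h
    have h2 : inner ℝ (r • R h) e = inner ℝ h ξ := by
      rw [real_inner_smul_left, ← real_inner_smul_right, ← hR, LinearIsometryEquiv.inner_map_map]
    have h3 : gagliardoKernel s h =
        ENNReal.ofReal (r ^ ((n : ℝ) + 2 * s)) * gagliardoKernel s (r • R h) := by
      rw [gagliardoKernel, gagliardoKernel, ← ENNReal.ofReal_mul (by positivity), norm_smul,
        LinearIsometryEquiv.norm_map, Real.norm_of_nonneg hr0.le,
        Real.mul_rpow hr0.le (norm_nonneg _), mul_inv, mul_inv_cancel_left₀ (by positivity)]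
    rw [h3, diffSymbol, diffSymbol, h2]
    ring
  have hR' : ∫⁻ h, (fun h => diffSymbol (r • h) e * gagliardoKernel s (r • h)) (R h) =
      ∫⁻ h, diffSymbol (r • h) e * gagliardoKernel s (r • h) :=
    R.measurePreserving.lintegral_comp (hmeas.comp (measurable_const_smul r))
  rw [gagliardoSymbol, lintegral_congr h1, lintegral_const_mul' _ _ ENNReal.ofReal_ne_top, hR',
    lintegral_comp_smul_eucl (f := fun h => diffSymbol h e * gagliardoKernel s h) hmeas hr0,
    ← mul_assoc, ← ENNReal.ofReal_mul (by positivity), gagliardoSymbol,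
    Real.rpow_add hr0, Real.rpow_natCast]
  congr 2
  field_simp

lemma diffSymbol_le (h e : Eucl n) (he : ‖e‖ = 1) :
    diffSymbol h e ≤ ENNReal.ofReal (min 4 ((2 * Real.pi) ^ 2 * ‖h‖ ^ 2)) := by
  rw [diffSymbol, ← ofReal_norm, ← ENNReal.ofReal_pow (norm_nonneg _)]
  refine ENNReal.ofReal_le_ofReal (le_min ?_ ?_)
  · have : ‖(Real.fourierChar (-inner ℝ h e) : ℂ) - 1‖ ≤ 2 := by
      refine (norm_sub_le _ _).trans ?_
      rw [Circle.norm_coe, norm_one]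
      norm_num
    nlinarith [norm_nonneg ((Real.fourierChar (-inner ℝ h e) : ℂ) - 1)]
  · rw [← mul_pow]
    refine pow_le_pow_left₀ (norm_nonneg _) ?_ 2
    rw [Real.fourierChar_apply, mul_comm _ Complex.I]
    refine (Real.norm_exp_I_mul_ofReal_sub_one_le).trans ?_
    have := abs_real_inner_le_norm h e
    rw [he, mul_one] at this
    rw [norm_mul, norm_neg, Real.norm_of_nonneg (by positivity), Real.norm_eq_abs]
    gcongr

/-- In polar coordinates the integrand is at most a multiple of `r^(1-2s)` near `0`, integrable
since `s < 1`, and of `r^(-1-2s)` at infinity, integrable since `s > 0`. -/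
theorem gagliardoSymbol_lt_top {s : ℝ} (hn : 1 ≤ n) (hs0 : 0 < s) (hs1 : s < 1)
    (e : Eucl n) (he : ‖e‖ = 1) : gagliardoSymbol s e < ⊤ := by
  have : Nonempty (Fin n) := ⟨⟨0, hn⟩⟩
  have : Nontrivial (Eucl n) := inferInstance
  set g : ℝ → ℝ := fun r => min 4 ((2 * Real.pi) ^ 2 * r ^ 2) * (r ^ ((n : ℝ) + 2 * s))⁻¹ with hg
  have hg0 : ∀ r, 0 ≤ r → 0 ≤ g r := fun r hr => by positivity
  have hint : Integrable (fun h : Eucl n => g ‖h‖) := by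
    rw [integrable_fun_norm_addHaar, finrank_euclideanSpace, Fintype.card_fin]
    have hpow : ∀ y : ℝ, 0 < y → y ^ (n - 1) * (y ^ ((n : ℝ) + 2 * s))⁻¹ = y ^ (-1 - 2 * s) := by
      intro y hy
      rw [← Real.rpow_natCast, ← Real.rpow_neg hy.le, ← Real.rpow_add hy]
      congr 1
      push_cast [hn]
      ring
    rw [← Set.Ioc_union_Ioi_eq_Ioi (zero_le_one' ℝ)]
    refine IntegrableOn.union ?_ ?_
    · have hi : IntegrableOn (fun y : ℝ => (2 * Real.pi) ^ 2 * y ^ (1 - 2 * s)) (Set.Ioc 0 1) := by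
        refine Integrable.const_mul ?_ _
        have := (intervalIntegral.intervalIntegrable_rpow' (a := 0) (b := 1)
          (r := 1 - 2 * s) (by linarith))
        exact (intervalIntegrable_iff_integrableOn_Ioc_of_le zero_le_one).mp this
      refine Integrable.mono' hi (by fun_prop) ?_
      filter_upwards [ae_restrict_mem measurableSet_Ioc] with y hy
      have hy0 := hy.1
      rw [smul_eq_mul, Real.norm_of_nonneg (mul_nonneg (by positivity) (hg0 y hy0.le))]
      calc y ^ (n - 1) * g y
          ≤ y ^ (n - 1) * ((2 * Real.pi) ^ 2 * y ^ 2 * (y ^ ((n : ℝ) + 2 * s))⁻¹) := by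
            simp only [hg]
            gcongr
            exact min_le_right _ _
        _ = (2 * Real.pi) ^ 2 * (y ^ 2 * (y ^ (n - 1) * (y ^ ((n : ℝ) + 2 * s))⁻¹)) := by ring
        _ = _ := by
          rw [hpow y hy0, ← Real.rpow_two y, ← Real.rpow_add hy0]
          ring_nf
    · have hi : IntegrableOn (fun y : ℝ => 4 * y ^ (-1 - 2 * s)) (Set.Ioi 1) :=
        Integrable.const_mul (integrableOn_Ioi_rpow_of_lt (by linarith) zero_lt_one) _
      refine Integrable.mono' hi (by fun_prop) ?_
      filter_upwards [ae_restrict_mem measurableSet_Ioi] with y hy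
      have hy0 : 0 < y := lt_trans zero_lt_one hy
      rw [smul_eq_mul, Real.norm_of_nonneg (mul_nonneg (by positivity) (hg0 y hy0.le))]
      calc y ^ (n - 1) * g y
          ≤ y ^ (n - 1) * (4 * (y ^ ((n : ℝ) + 2 * s))⁻¹) := by
            simp only [hg]
            gcongr
            exact min_le_left _ _
        _ = 4 * (y ^ (n - 1) * (y ^ ((n : ℝ) + 2 * s))⁻¹) := by ring
        _ = _ := by rw [hpow y hy0]
  refine lt_of_le_of_lt (lintegral_mono fun h => ?_) hint.lintegral_lt_top
  rw [hg, ENNReal.ofReal_mul (by positivity)]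
  exact mul_le_mul_left (diffSymbol_le h e he) _

theorem gagliardoSymbol_pos {s : ℝ} (e : Eucl n) (he : ‖e‖ = 1) : 0 < gagliardoSymbol s e := by
  have hmeas : Measurable fun h : Eucl n => diffSymbol h e * gagliardoKernel s h :=
    (measurable_diffSymbol.comp (measurable_id.prodMk measurable_const)).mul (by fun_prop)
  set O : Set (Eucl n) := {h | h ≠ 0 ∧ (Real.fourierChar (-inner ℝ h e) : ℂ) ≠ 1} with hO
  have hOo : IsOpen O := by
    refine IsOpen.inter isOpen_ne (isOpen_ne_fun (by fun_prop) continuous_const)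
  have hOn : O.Nonempty := by
    -- At `h = e/2` the character equals `exp(-iπ) = -1`.
    refine ⟨(1 / 2 : ℝ) • e, ?_, ?_⟩
    · have : e ≠ 0 := by
        rintro rfl
        simp at he
      exact smul_ne_zero (by norm_num) this
    · rw [real_inner_smul_left, real_inner_self_eq_norm_sq, he, Real.fourierChar_apply]
      have : ((2 * Real.pi * -(1 / 2 * 1 ^ 2) : ℝ) : ℂ) * Complex.I =
        -(Real.pi * Complex.I) := by push_cast; ring
      rw [this, Complex.exp_neg, Complex.exp_pi_mul_I]
      norm_num
  rw [gagliardoSymbol, lintegral_pos_iff_support hmeas]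
  refine (hOo.measure_pos volume hOn).trans_le (measure_mono fun h hh => ?_)
  have h1 : 0 < ‖h‖ := norm_pos_iff.mpr hh.1
  refine mul_ne_zero (pow_ne_zero _ ?_) ?_
  · simpa [sub_eq_zero] using hh.2
  · rw [gagliardoKernel, Ne, ENNReal.ofReal_eq_zero, not_le]
    positivity

/-- The value of `c` is not needed: it affects only boundedness and coercivity, not the constant of
the error estimate. -/
theorem exists_gagliardoSymbol_eq {s : ℝ} (hn : 1 ≤ n) (hs0 : 0 < s) (hs1 : s < 1) :
    ∃ c : ℝ, 0 < c ∧ ∀ᵐ ξ : Eucl n, gagliardoSymbol s ξ = ENNReal.ofReal (c * ‖ξ‖ ^ (2 * s)) := by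
  have : Nonempty (Fin n) := ⟨⟨0, hn⟩⟩
  have : Nontrivial (Eucl n) := inferInstance
  obtain ⟨e, he⟩ := exists_norm_eq (Eucl n) (zero_le_one' ℝ)
  have hfin := gagliardoSymbol_lt_top hn hs0 hs1 e he
  refine ⟨(gagliardoSymbol s e).toReal,
    ENNReal.toReal_pos (gagliardoSymbol_pos e he).ne' hfin.ne, ?_⟩
  filter_upwards [compl_mem_ae_iff.mpr (measure_singleton (0 : Eucl n))] with ξ hξ
  rw [gagliardoSymbol_eq e he hξ, ENNReal.ofReal_mul ENNReal.toReal_nonneg,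
    ENNReal.ofReal_toReal hfin.ne, mul_comm]

end Symbol

/-! ### The Hilbert space structure of `Hˢ(ℝⁿ)` and `H̃ˢ(Ω)` -/

section Hilbert

variable {n : ℕ} {s : ℝ} {Ω : Set (Eucl n)}

/-- The inner product is pulled back along the same map as the norm, so the two are compatible;
Lax–Milgram needs this structure. -/
instance : InnerProductSpace ℝ (Hs n s) where
  inner v w := inner ℝ (Hs.bessel n s v) (Hs.bessel n s w)
  norm_sq_eq_re_inner v := norm_sq_eq_re_inner (𝕜 := ℝ) (Hs.bessel n s v)
  conj_inner_symm v w := inner_conj_symm (𝕜 := ℝ) (Hs.bessel n s v) (Hs.bessel n s w)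
  add_left u v w := by rw [map_add, inner_add_left]
  smul_left v w r := by rw [map_smul, inner_smul_left]

lemma Hs.norm_eq (v : Hs n s) : ‖v‖ = ‖Hs.bessel n s v‖ := rfl

lemma Hs.coeFn_bessel (v : Hs n s) :
    Hs.bessel n s v =ᵐ[volume] weightedFourier s (Hs.toL2 n s v) :=
  MemLp.coeFn_toLp v.2

lemma Hs.enorm_sq (v : Hs n s) :
    ‖v‖ₑ ^ 2 = ∫⁻ ξ : Eucl n,
      ENNReal.ofReal ((1 + ‖ξ‖ ^ 2) ^ s) * ‖fourierL2 (Hs.toL2 n s v) ξ‖ₑ ^ 2 := by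
  have h1 : ‖v‖ₑ = ‖Hs.bessel n s v‖ₑ := by
    rw [← ofReal_norm, ← ofReal_norm, Hs.norm_eq]
  rw [h1, Lp_enorm_sq]
  apply lintegral_congr_ae
  filter_upwards [Hs.coeFn_bessel v] with ξ hξ
  rw [hξ, weightedFourier, enorm_smul, mul_pow]
  congr 1
  rw [Real.enorm_of_nonneg (by positivity), ← ENNReal.ofReal_pow (by positivity),
    ← Real.rpow_natCast, ← Real.rpow_mul (by positivity)]
  congr 2
  push_cast
  ring

lemma norm_fourierL2 (v : L2Space n) : ‖fourierL2 v‖ = ‖v‖ := by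
  rw [fourierL2, Lp.norm_fourier_eq, Lp.norm_def, Lp.norm_def]
  congr 1
  refine eLpNorm_congr_norm_ae ?_
  filter_upwards [Complex.ofRealCLM.coeFn_compLpL v] with x hx
  rw [hx, Complex.ofRealCLM_apply, Complex.norm_real]

lemma continuous_fourierL2 : Continuous (fourierL2 : L2Space n → _) := by
  have hF : Continuous (fun v : Lp ℂ 2 (volume : Measure (Eucl n)) => 𝓕 v) :=
    (Lp.fourierTransformₗᵢ (Eucl n) ℂ).continuous
  exact hF.comp (Complex.ofRealCLM.compLpL 2 volume).continuous

lemma L2_enorm_sq_eq_fourier (v : L2Space n) : ‖v‖ₑ ^ 2 = ∫⁻ ξ, ‖fourierL2 v ξ‖ₑ ^ 2 := by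
  rw [← Lp_enorm_sq, ← ofReal_norm, ← ofReal_norm, norm_fourierL2]

lemma Hs.norm_toL2_le (hs : 0 ≤ s) (v : Hs n s) : ‖Hs.toL2 n s v‖ ≤ ‖v‖ := by
  have h : ‖Hs.toL2 n s v‖ₑ ^ 2 ≤ ‖v‖ₑ ^ 2 := by
    rw [Hs.enorm_sq, L2_enorm_sq_eq_fourier]
    refine lintegral_mono fun ξ => ?_
    refine le_mul_of_one_le_left' ?_
    rw [ENNReal.one_le_ofReal]
    exact Real.one_le_rpow (by nlinarith [sq_nonneg ‖ξ‖]) hs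
  exact enorm_le_iff_norm_le.mp ((ENNReal.pow_le_pow_left_iff two_ne_zero).mp h)

/-- The inclusion `Hˢ(ℝⁿ) → L²(ℝⁿ)` as a continuous linear map. -/
def Hs.toL2CLM (n : ℕ) {s : ℝ} (hs : 0 ≤ s) : Hs n s →L[ℝ] L2Space n :=
  LinearMap.mkContinuous (Hs.toL2 n s) 1 fun v => by
    rw [one_mul]
    exact Hs.norm_toL2_le hs v

lemma Hs.toL2CLM_apply (hs : 0 ≤ s) (v : Hs n s) : Hs.toL2CLM n hs v = Hs.toL2 n s v := rfl

/-- For a Cauchy sequence both the functions and their weighted transforms converge in `L²`. Along a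
common subsequence both transforms converge a.e., which identifies the second limit as the weighted
transform of the first. -/
theorem Hs.completeSpace (hs : 0 ≤ s) : CompleteSpace (Hs n s) := by
  refine Metric.complete_of_cauchySeq_tendsto fun v hv => ?_
  have hiso : Isometry (Hs.bessel n s) :=
    AddMonoidHomClass.isometry_of_norm _ fun v => (Hs.norm_eq v).symm
  obtain ⟨g, hg⟩ := cauchySeq_tendsto_of_complete (hiso.uniformContinuous.comp_cauchySeq hv)
  obtain ⟨w, hw⟩ := cauchySeq_tendsto_of_complete
    ((Hs.toL2CLM n hs).uniformContinuous.comp_cauchySeq hv)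
  have hFw := (continuous_fourierL2.tendsto w).comp hw
  obtain ⟨a, ha, ha'⟩ := (tendstoInMeasure_of_tendsto_Lp hg).exists_seq_tendsto_ae
  obtain ⟨b, hb, hb'⟩ :=
    (tendstoInMeasure_of_tendsto_Lp (hFw.comp ha.tendsto_atTop)).exists_seq_tendsto_ae
  have hae : weightedFourier s w =ᵐ[volume] g := by
    have hall : ∀ᵐ ξ, ∀ k, Hs.bessel n s (v k) ξ = weightedFourier s (Hs.toL2 n s (v k)) ξ :=
      ae_all_iff.mpr fun k => Hs.coeFn_bessel (v k)
    filter_upwards [ha', hb', hall] with ξ h1 h2 h3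
    have h4 := h1.comp hb.tendsto_atTop
    have h5 := h2.const_smul (((1 + ‖ξ‖ ^ 2) ^ (s / 2) : ℝ))
    refine tendsto_nhds_unique h5 (h4.congr fun k => ?_)
    simp only [Function.comp_apply]
    rw [h3]
    rfl
  have hwm : w ∈ sobolevSubmodule n s := MemLp.ae_eq hae.symm (Lp.memLp g)
  let W : Hs n s := ⟨w, hwm⟩
  have hWg : Hs.bessel n s W = g := by
    apply Lp.ext
    exact (Hs.coeFn_bessel W).trans hae
  refine ⟨W, ?_⟩
  rw [← hWg] at hg
  exact hiso.isEmbedding.tendsto_nhds_iff.mpr hg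

theorem HsTilde.completeSpace (hs : 0 ≤ s) : CompleteSpace (HsTilde n s Ω) := by
  have := Hs.completeSpace (n := n) hs
  exact (Submodule.isClosed_topologicalClosure (testFunctions n s Ω)).completeSpace_coe

/-- Restriction to `Ω` loses nothing for a test function supported in `Ω`, and the equality passes
to limits in `Hˢ`. No regularity of the boundary is involved. -/
lemma norm_toL2On (hs : 0 ≤ s) (v : HsTilde n s Ω) :
    ‖toL2On v‖ = ‖Hs.toL2 n s (v : Hs n s)‖ := by
  have hclosed : IsClosed {v : Hs n s |
      ‖LpToLpRestrictCLM (Eucl n) ℝ ℝ volume 2 Ω (Hs.toL2CLM n hs v)‖ = ‖Hs.toL2CLM n hs v‖} :=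
    isClosed_eq (by fun_prop) (by fun_prop)
  refine closure_minimal ?_ hclosed v.2
  rintro v ⟨φ, -, -, hφ, hv⟩
  rw [Set.mem_ofPred_eq, Hs.toL2CLM_apply, Lp.norm_def, Lp.norm_def]
  congr 1
  rw [eLpNorm_congr_ae (LpToLpRestrictCLM_coeFn ℝ Ω _), eLpNorm_congr_ae hv,
    eLpNorm_congr_ae (ae_restrict_of_ae hv),
    eLpNorm_restrict_eq_of_support_subset ((subset_tsupport φ).trans hφ)]

lemma norm_toL2On_le (hs : 0 ≤ s) (v : HsTilde n s Ω) : ‖toL2On v‖ ≤ ‖v‖ := by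
  rw [norm_toL2On hs]
  exact Hs.norm_toL2_le hs _

/-- The inclusion `H̃ˢ(Ω) → L²(Ω)` as a continuous linear map. -/
def toL2OnCLM (Ω : Set (Eucl n)) (hs : 0 ≤ s) : HsTilde n s Ω →L[ℝ] L2On Ω :=
  LinearMap.mkContinuous toL2On 1 fun v => by
    rw [one_mul]
    exact norm_toL2On_le hs v

end Hilbert

/-! ### The energy form -/

section Energy

variable {n : ℕ} {s : ℝ} {Ω : Set (Eucl n)}

/-- The difference quotient `(v(x) - v(y)) / |x - y|^((n+2s)/2)`. -/
def gagliardoQuotient (s : ℝ) (v : Eucl n → ℝ) (p : Eucl n × Eucl n) : ℝ :=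
  (v p.1 - v p.2) / ‖p.1 - p.2‖ ^ (((n : ℝ) + 2 * s) / 2)

lemma gagliardoQuotient_mul (s : ℝ) (v w : Eucl n → ℝ) (p : Eucl n × Eucl n) :
    gagliardoQuotient s v p * gagliardoQuotient s w p =
      (v p.1 - v p.2) * (w p.1 - w p.2) / ‖p.1 - p.2‖ ^ ((n : ℝ) + 2 * s) := by
  rw [gagliardoQuotient, gagliardoQuotient, div_mul_div_comm]
  congr 1
  rw [← sq, ← Real.rpow_natCast, ← Real.rpow_mul (norm_nonneg _)]
  congr 1
  push_cast
  ring

lemma enorm_gagliardoQuotient_sq (s : ℝ) (v : Eucl n → ℝ) (p : Eucl n × Eucl n) :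
    ‖gagliardoQuotient s v p‖ₑ ^ 2 =
      ‖v p.1 - v p.2‖ₑ ^ 2 * gagliardoKernel s (p.1 - p.2) := by
  rw [← ofReal_norm, ← ofReal_norm, ← ENNReal.ofReal_pow (norm_nonneg _),
    ← ENNReal.ofReal_pow (norm_nonneg _), gagliardoKernel, ← ENNReal.ofReal_mul (by positivity)]
  congr 1
  rw [Real.norm_eq_abs, Real.norm_eq_abs, sq_abs, sq_abs, sq, gagliardoQuotient_mul, div_eq_mul_inv,
    sq]

lemma lintegral_gagliardoQuotient {c : ℝ}
    (hc : ∀ᵐ ξ : Eucl n, gagliardoSymbol s ξ = ENNReal.ofReal (c * ‖ξ‖ ^ (2 * s)))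
    (v : L2Space n) :
    ∫⁻ p, ‖gagliardoQuotient s v p‖ₑ ^ 2 =
      ∫⁻ ξ, ENNReal.ofReal (c * ‖ξ‖ ^ (2 * s)) * ‖fourierL2 v ξ‖ₑ ^ 2 := by
  simp_rw [enorm_gagliardoQuotient_sq]
  rw [lintegral_gagliardo]
  apply lintegral_congr_ae
  filter_upwards [hc] with ξ hξ
  rw [hξ]

lemma lintegral_gagliardoQuotient_le {c : ℝ} (hs0 : 0 < s) (hc0 : 0 < c)
    (hc : ∀ᵐ ξ : Eucl n, gagliardoSymbol s ξ = ENNReal.ofReal (c * ‖ξ‖ ^ (2 * s)))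
    (v : Hs n s) :
    ∫⁻ p, ‖gagliardoQuotient s (Hs.toL2 n s v) p‖ₑ ^ 2 ≤ ENNReal.ofReal c * ‖v‖ₑ ^ 2 := by
  rw [lintegral_gagliardoQuotient hc, Hs.enorm_sq, ← lintegral_const_mul' _ _ ENNReal.ofReal_ne_top]
  refine lintegral_mono fun ξ => ?_
  rw [← mul_assoc, ← ENNReal.ofReal_mul hc0.le]
  gcongr
  rw [Real.rpow_mul (norm_nonneg _)]
  gcongr
  rw [Real.rpow_two]
  linarith

/-- Subadditivity of `a ↦ a^s` for `s < 1` gives `(1 + |ξ|²)^s ≤ 1 + |ξ|^(2s)`; this is the source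
of coercivity. -/
lemma Hs.enorm_sq_le {c : ℝ} (hs0 : 0 < s) (hs1 : s < 1) (hc0 : 0 < c)
    (hc : ∀ᵐ ξ : Eucl n, gagliardoSymbol s ξ = ENNReal.ofReal (c * ‖ξ‖ ^ (2 * s)))
    (v : Hs n s) :
    ‖v‖ₑ ^ 2 ≤ ‖Hs.toL2 n s v‖ₑ ^ 2 +
      ENNReal.ofReal c⁻¹ * ∫⁻ p, ‖gagliardoQuotient s (Hs.toL2 n s v) p‖ₑ ^ 2 := by
  have hF : Measurable (fourierL2 (Hs.toL2 n s v) : Eucl n → ℂ) :=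
    (Lp.stronglyMeasurable _).measurable
  rw [lintegral_gagliardoQuotient hc, Hs.enorm_sq, L2_enorm_sq_eq_fourier,
    ← lintegral_const_mul' _ _ ENNReal.ofReal_ne_top, ← lintegral_add_left (by fun_prop)]
  refine lintegral_mono fun ξ => ?_
  rw [← mul_assoc, ← ENNReal.ofReal_mul (by positivity), inv_mul_cancel_left₀ hc0.ne']
  nth_rewrite 2 [← one_mul (‖fourierL2 (Hs.toL2 n s v) ξ‖ₑ ^ 2)]
  rw [← add_mul, ← ENNReal.ofReal_one, ← ENNReal.ofReal_add zero_le_one (by positivity)]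
  gcongr
  have h := NNReal.rpow_add_le_add_rpow 1 (‖ξ‖₊ ^ 2) hs0.le hs1.le
  have h' : ((1 : ℝ) + ‖ξ‖ ^ 2) ^ s ≤ 1 ^ s + (‖ξ‖ ^ 2) ^ s := by exact_mod_cast h
  have h2 : (‖ξ‖ ^ 2) ^ s = ‖ξ‖ ^ (2 * s) := by
    rw [← Real.rpow_two, ← Real.rpow_mul (norm_nonneg _)]
  rwa [Real.one_rpow, h2] at h'

lemma measurable_gagliardoQuotient (s : ℝ) (v : L2Space n) :
    Measurable (gagliardoQuotient s v : Eucl n × Eucl n → ℝ) := by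
  have hv : Measurable (v : Eucl n → ℝ) := (Lp.stronglyMeasurable v).measurable
  unfold gagliardoQuotient
  fun_prop

lemma gagliardoQuotient_add (s : ℝ) (v w : L2Space n) :
    gagliardoQuotient s (v + w : L2Space n) =ᵐ[volume]
      gagliardoQuotient s v + gagliardoQuotient s w := by
  have h := Lp.coeFn_add v w
  filter_upwards [(Measure.quasiMeasurePreserving_fst (μ := (volume : Measure (Eucl n)))
      (ν := (volume : Measure (Eucl n)))).ae_eq_comp h,
    (Measure.quasiMeasurePreserving_snd (μ := (volume : Measure (Eucl n)))
      (ν := (volume : Measure (Eucl n)))).ae_eq_comp h] with p h1 h2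
  simp only [Function.comp_apply, Pi.add_apply] at h1 h2
  rw [Pi.add_apply, gagliardoQuotient, gagliardoQuotient, gagliardoQuotient, h1, h2]
  ring

lemma gagliardoQuotient_smul (s c : ℝ) (v : L2Space n) :
    gagliardoQuotient s (c • v : L2Space n) =ᵐ[volume] c • gagliardoQuotient s v := by
  have h := Lp.coeFn_smul c v
  filter_upwards [(Measure.quasiMeasurePreserving_fst (μ := (volume : Measure (Eucl n)))
      (ν := (volume : Measure (Eucl n)))).ae_eq_comp h,
    (Measure.quasiMeasurePreserving_snd (μ := (volume : Measure (Eucl n)))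
      (ν := (volume : Measure (Eucl n)))).ae_eq_comp h] with p h1 h2
  simp only [Function.comp_apply, Pi.smul_apply, smul_eq_mul] at h1 h2
  rw [Pi.smul_apply, gagliardoQuotient, gagliardoQuotient, h1, h2, smul_eq_mul]
  ring

/-- The Gagliardo seminorm and the energy form come from a bounded linear map into a Hilbert space,
and the seminorm controls the norm of `H̃ˢ(Ω)` up to the norm of `L²(Ω)`. -/
theorem exists_gagliardoMap (hn : 1 ≤ n) (hs0 : 0 < s) (hs1 : s < 1) :
    ∃ D : HsTilde n s Ω →L[ℝ] Lp ℝ 2 (volume : Measure (Eucl n × Eucl n)),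
      (∀ v w, energyForm v w = fracConst n s / 2 * inner ℝ (D v) (D w)) ∧
      (∀ v, sobolevSeminorm v = ‖D v‖) ∧
      ∃ c : ℝ, 0 < c ∧ ∀ v, ‖v‖ ^ 2 ≤ ‖toL2On v‖ ^ 2 + c * ‖D v‖ ^ 2 := by
  obtain ⟨c, hc0, hc⟩ := exists_gagliardoSymbol_eq (n := n) hn hs0 hs1
  have hmem : ∀ v : HsTilde n s Ω, MemLp (gagliardoQuotient s (Hs.toL2 n s v)) 2 volume := by
    intro v
    refine ⟨(measurable_gagliardoQuotient s _).aestronglyMeasurable, ?_⟩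
    rw [eLpNorm_lt_top_iff_lintegral_rpow_enorm_lt_top (by simp) (by simp)]
    simp only [ENNReal.toReal_ofNat, ENNReal.rpow_ofNat]
    refine (lintegral_gagliardoQuotient_le hs0 hc0 hc (v : Hs n s)).trans_lt ?_
    exact ENNReal.mul_lt_top ENNReal.ofReal_lt_top (ENNReal.pow_lt_top enorm_lt_top)
  -- The kernel is split into two square roots, one for each factor, so that the energy integral is
  -- an `L²` inner product of difference quotients.
  let D₀ : HsTilde n s Ω →ₗ[ℝ] Lp ℝ 2 (volume : Measure (Eucl n × Eucl n)) :=
    { toFun := fun v => (hmem v).toLp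
      map_add' := fun v w => by
        rw [← MemLp.toLp_add]
        refine MemLp.toLp_congr _ _ ?_
        rw [Submodule.coe_add, map_add]
        exact gagliardoQuotient_add s _ _
      map_smul' := fun a v => by
        rw [RingHom.id_apply, ← MemLp.toLp_const_smul]
        refine MemLp.toLp_congr _ _ ?_
        rw [Submodule.coe_smul, map_smul]
        exact gagliardoQuotient_smul s a _ }
  have hcoe : ∀ v, D₀ v =ᵐ[volume] gagliardoQuotient s (Hs.toL2 n s v) :=
    fun v => (hmem v).coeFn_toLp
  have hsq : ∀ v, ‖D₀ v‖ₑ ^ 2 = ∫⁻ p, ‖gagliardoQuotient s (Hs.toL2 n s v) p‖ₑ ^ 2 := by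
    intro v
    rw [Lp_enorm_sq]
    apply lintegral_congr_ae
    filter_upwards [hcoe v] with p hp
    rw [hp]
  have henorm : ∀ {E : Type} [NormedAddCommGroup E] (x : E), ‖x‖ₑ ^ 2 = ENNReal.ofReal (‖x‖ ^ 2) :=
    fun x => by rw [← ofReal_norm, ENNReal.ofReal_pow (norm_nonneg _)]
  have hbound : ∀ v, ‖D₀ v‖ ≤ Real.sqrt c * ‖v‖ := by
    intro v
    have h := lintegral_gagliardoQuotient_le hs0 hc0 hc (v : Hs n s)
    rw [← hsq, henorm, henorm, ← ENNReal.ofReal_mul hc0.le,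
      ENNReal.ofReal_le_ofReal_iff (by positivity)] at h
    have h2 : ‖D₀ v‖ ^ 2 ≤ (Real.sqrt c * ‖v‖) ^ 2 := by
      rw [mul_pow, Real.sq_sqrt hc0.le]
      exact h
    exact (pow_le_pow_iff_left₀ (norm_nonneg _) (by positivity) two_ne_zero).mp h2
  have hinner : ∀ v w, inner ℝ (D₀ v) (D₀ w) = ∫ p : Eucl n × Eucl n,
      (toFun v p.1 - toFun v p.2) * (toFun w p.1 - toFun w p.2) /
        ‖p.1 - p.2‖ ^ ((n : ℝ) + 2 * s) := by
    intro v w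
    rw [L2.inner_def]
    apply integral_congr_ae
    filter_upwards [hcoe v, hcoe w] with p h1 h2
    rw [h1, h2, real_inner_eq_re_inner, RCLike.inner_apply, mul_comm]
    exact gagliardoQuotient_mul s _ _ p
  refine ⟨D₀.mkContinuous (Real.sqrt c) hbound, fun v w => ?_, fun v => ?_, c⁻¹, by positivity,
    fun v => ?_⟩
  · rw [energyForm, LinearMap.mkContinuous_apply, LinearMap.mkContinuous_apply, hinner]
  · rw [LinearMap.mkContinuous_apply, sobolevSeminorm, norm_eq_sqrt_real_inner, hinner]
    simp_rw [sq]
  · rw [LinearMap.mkContinuous_apply, norm_toL2On hs0.le]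
    have h := Hs.enorm_sq_le hs0 hs1 hc0 hc (v : Hs n s)
    rw [← hsq, henorm, henorm, henorm, ← ENNReal.ofReal_mul (by positivity),
      ← ENNReal.ofReal_add (by positivity) (by positivity),
      ENNReal.ofReal_le_ofReal_iff (by positivity)] at h
    exact h

lemma fracConst_pos (hs0 : 0 < s) (hs1 : s < 1) : 0 < fracConst n s := by
  have h1 : 0 < Real.Gamma (s + n / 2) := Real.Gamma_pos_of_pos (by positivity)
  have h2 : 0 < Real.Gamma (1 - s) := Real.Gamma_pos_of_pos (by linarith)
  unfold fracConst
  positivity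

end Energy

/-! ### The backward Euler scheme in a Hilbert space -/

section Abstract

/-- Triangle inequality along the path, then Cauchy–Schwarz, which costs the factor `N`. -/
lemma norm_sub_sq_le_mul_sum {X : Type*} [SeminormedAddCommGroup X] (x : ℕ → X) (a N : ℕ) {p q : ℕ} (hp : p ≤ N) (hq : q ≤ N) :
    ‖x (a + q) - x (a + p)‖ ^ 2 ≤
      N * ∑ i ∈ Finset.range N, ‖x (a + i + 1) - x (a + i)‖ ^ 2 := by
  wlog hpq : p ≤ q generalizing p q
  · rw [norm_sub_rev]
    exact this hq hp (by omega)
  have h1 : ‖x (a + q) - x (a + p)‖ ≤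
      ∑ i ∈ Finset.range N, ‖x (a + i + 1) - x (a + i)‖ := by
    have h2 := dist_le_Ico_sum_dist (fun i => x (a + i)) hpq
    rw [dist_comm, dist_eq_norm] at h2
    refine h2.trans ?_
    refine (Finset.sum_le_sum_of_subset_of_nonneg (t := Finset.range N) ?_
      fun _ _ _ => dist_nonneg).trans_eq ?_
    · intro i hi
      rw [Finset.mem_Ico] at hi
      exact Finset.mem_range.mpr (by omega)
    · refine Finset.sum_congr rfl fun i _ => ?_
      rw [dist_comm, dist_eq_norm, add_assoc]
  calc ‖x (a + q) - x (a + p)‖ ^ 2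
      ≤ (∑ i ∈ Finset.range N, ‖x (a + i + 1) - x (a + i)‖) ^ 2 := by gcongr
    _ ≤ _ := by
      have := sq_sum_le_card_mul_sum_sq (s := Finset.range N)
        (f := fun i => ‖x (a + i + 1) - x (a + i)‖)
      rwa [Finset.card_range] at this

variable {V H W : Type*} [NormedAddCommGroup V] [InnerProductSpace ℝ V]
  [NormedAddCommGroup H] [InnerProductSpace ℝ H] [NormedAddCommGroup W] [InnerProductSpace ℝ W]
  {ι : V →L[ℝ] H} {A : V →L[ℝ] W}

/-- The discrete duality estimate: the error `e` of nodal values and the error `d` of averages of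
two solutions of the same time-integrated problem. -/
theorem sum_norm_sq_le_of_integrated {τ : ℝ} (hτ : 0 < τ) {K : ℕ} {E d : ℕ → V} {e : ℕ → H}
    (hE0 : E 0 = 0) (hE : ∀ m < K, E (m + 1) = E m + τ • d m)
    (he : ∀ m < K, ∀ φ, inner ℝ (e m) (ι φ) + inner ℝ (A (E (m + 1))) (A φ) = 0) :
    ∑ m ∈ Finset.range K, ‖ι (d m)‖ ^ 2 ≤ ∑ m ∈ Finset.range K, ‖ι (d m) - e m‖ ^ 2 := by
  -- Test with `d M`. As `τ • d M = E (M + 1) - E M`, the diffusion term is at least half the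
  -- increment of `‖A E‖²`, and these increments telescope from `E 0 = 0`.
  have hsum : ∀ M ≤ K, 2 * τ * ∑ m ∈ Finset.range M, inner ℝ (e m) (ι (d m)) ≤
      -‖A (E M)‖ ^ 2 := by
    intro M
    induction M with
    | zero => simp [hE0]
    | succ M ih =>
      intro hM
      have h1 := he M (by omega) (d M)
      have h2 : τ * inner ℝ (A (E (M + 1))) (A (d M)) =
          ‖A (E (M + 1))‖ ^ 2 - inner ℝ (A (E (M + 1))) (A (E M)) := by
        rw [← real_inner_smul_right, ← map_smul, ← real_inner_self_eq_norm_sq, ← inner_sub_right,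
          ← map_sub]
        congr 2
        rw [eq_sub_iff_add_eq, add_comm, ← hE M (by omega)]
      have h3 := norm_sub_sq_real (A (E (M + 1))) (A (E M))
      have h4 := sq_nonneg ‖A (E (M + 1)) - A (E M)‖
      have h5 := ih (by omega)
      rw [Finset.sum_range_succ, mul_add]
      have h6 : τ * inner ℝ (e M) (ι (d M)) = -(τ * inner ℝ (A (E (M + 1))) (A (d M))) := by
        rw [← mul_neg]
        congr 1
        linarith
      linarith
  have h0 : ∑ m ∈ Finset.range K, inner ℝ (e m) (ι (d m)) ≤ 0 := by
    have h1 := hsum K le_rfl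
    have h2 := sq_nonneg ‖A (E K)‖
    by_contra! h
    have := mul_pos (mul_pos two_pos hτ) h
    linarith
  -- Expand `‖ι d - e‖²` and drop `‖e‖²`.
  have h1 : ∀ m, ‖ι (d m)‖ ^ 2 ≤ ‖ι (d m) - e m‖ ^ 2 + 2 * inner ℝ (e m) (ι (d m)) := by
    intro m
    have := norm_sub_sq_real (ι (d m)) (e m)
    rw [real_inner_comm] at this
    nlinarith [sq_nonneg ‖e m‖]
  calc ∑ m ∈ Finset.range K, ‖ι (d m)‖ ^ 2
      ≤ ∑ m ∈ Finset.range K, (‖ι (d m) - e m‖ ^ 2 + 2 * inner ℝ (e m) (ι (d m))) :=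
        Finset.sum_le_sum fun m _ => h1 m
    _ = ∑ m ∈ Finset.range K, ‖ι (d m) - e m‖ ^ 2 +
        2 * ∑ m ∈ Finset.range K, inner ℝ (e m) (ι (d m)) := by
        rw [Finset.sum_add_distrib, Finset.mul_sum]
    _ ≤ _ := by linarith

/-- `K` steps of the backward Euler scheme for `∂ₜ(ι U) + A*A U = f`. -/
def IsEuler (ι : V →L[ℝ] H) (A : V →L[ℝ] W) (τ : ℝ) (K : ℕ) (f : ℕ → H) (U : ℕ → V) : Prop :=
  ∀ k < K, ∀ φ, inner ℝ (ι (U (k + 1)) - ι (U k)) (ι φ) + τ * inner ℝ (A (U (k + 1))) (A φ) =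
    τ * inner ℝ (f k) (ι φ)

/-- The discrete energy estimate, obtained by testing with the increment `U (k + 1) - U k`. It needs
only `A (U 0)` and the data, and so is uniform over the refined grids. -/
theorem IsEuler.sum_norm_sub_sq_le {τ : ℝ} (hτ : 0 < τ) {K : ℕ} {f : ℕ → H} {U : ℕ → V}
    (h : IsEuler ι A τ K f U) :
    ∑ k ∈ Finset.range K, ‖ι (U (k + 1)) - ι (U k)‖ ^ 2 ≤
      τ * (‖A (U 0)‖ ^ 2 + τ * ∑ k ∈ Finset.range K, ‖f k‖ ^ 2) := by
  have hM : ∀ M ≤ K, ∑ k ∈ Finset.range M, ‖ι (U (k + 1)) - ι (U k)‖ ^ 2 + τ * ‖A (U M)‖ ^ 2 ≤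
      τ * (‖A (U 0)‖ ^ 2 + τ * ∑ k ∈ Finset.range M, ‖f k‖ ^ 2) := by
    intro M
    induction M with
    | zero => simp
    | succ M ih =>
      intro hMK
      have h1 := h M (by omega) (U (M + 1) - U M)
      rw [map_sub, map_sub, real_inner_self_eq_norm_sq, inner_sub_right,
        real_inner_self_eq_norm_sq] at h1
      set δ := ι (U (M + 1)) - ι (U M)
      -- Young's inequality; twice the tested equation contains `2‖δ‖²`, of which one half is spent
      -- here.
      have h2 : 2 * (τ * inner ℝ (f M) δ) ≤ τ ^ 2 * ‖f M‖ ^ 2 + ‖δ‖ ^ 2 := by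
        have := norm_sub_sq_real (τ • f M) δ
        rw [real_inner_smul_left, norm_smul, mul_pow, Real.norm_eq_abs, sq_abs] at this
        nlinarith [sq_nonneg ‖τ • f M - δ‖]
      have h3 := mul_nonneg hτ.le (sq_nonneg ‖A (U (M + 1)) - A (U M)‖)
      rw [norm_sub_sq_real] at h3
      rw [Finset.sum_range_succ, Finset.sum_range_succ]
      have h4 := ih (by omega)
      nlinarith
  have h1 := hM K le_rfl
  have := mul_nonneg hτ.le (sq_nonneg ‖A (U K)‖)
  linarith

/-- Summing the steps leaves only the nodal value at step `m`. Subtracting two such identities with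
the same data gives the orthogonality required by `sum_norm_sq_le_of_integrated`. -/
theorem IsEuler.integrated {τ : ℝ} {K : ℕ} {f : ℕ → H} {U : ℕ → V} (h : IsEuler ι A τ K f U)
    (m : ℕ) (hm : m ≤ K) (φ : V) :
    inner ℝ (ι (U m) - ι (U 0)) (ι φ) +
        inner ℝ (A (∑ k ∈ Finset.range m, τ • U (k + 1))) (A φ) =
      inner ℝ (∑ k ∈ Finset.range m, τ • f k) (ι φ) := by
  induction m with
  | zero => simp
  | succ m ih =>
    rw [Finset.sum_range_succ, Finset.sum_range_succ, map_add, inner_add_left, inner_add_left,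
      map_smul, real_inner_smul_left, real_inner_smul_left, ← ih (by omega), ← h m (by omega) φ,
      ← sub_add_sub_cancel (ι (U (m + 1))) (ι (U m)) (ι (U 0)), inner_add_left]
    ring

/-- Lax–Milgram at each step, for the form `⟪ι v, ι w⟫ + τ ⟪A v, A w⟫`. -/
theorem IsEuler.exists_solution [CompleteSpace V] {τ : ℝ} (hτ : 0 < τ) {c : ℝ}
    (hc : 0 < c) (hcoer : ∀ v, ‖v‖ ^ 2 ≤ ‖ι v‖ ^ 2 + c * ‖A v‖ ^ 2) (K : ℕ) (f : ℕ → H) (u₀ : V) :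
    ∃ U : ℕ → V, U 0 = u₀ ∧ IsEuler ι A τ K f U := by
  let B : V →L[ℝ] V →L[ℝ] ℝ :=
    (innerSL ℝ).bilinearComp ι ι + τ • (innerSL ℝ).bilinearComp A A
  have hB : ∀ v w, B v w = inner ℝ (ι v) (ι w) + τ * inner ℝ (A v) (A w) := fun v w => rfl
  have hBc : IsCoercive B := by
    -- Multiplying the form by `1 + c/τ` produces both `‖ι v‖²` and `c ‖A v‖²`, hence dominates
    -- `‖v‖²`.
    refine ⟨(1 + c / τ)⁻¹, by positivity, fun v => ?_⟩
    rw [hB, real_inner_self_eq_norm_sq, real_inner_self_eq_norm_sq, mul_assoc, ← sq,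
      inv_mul_le_iff₀ (by positivity)]
    refine (hcoer v).trans ?_
    have h1 : (1 + c / τ) * (‖ι v‖ ^ 2 + τ * ‖A v‖ ^ 2) =
        ‖ι v‖ ^ 2 + c * ‖A v‖ ^ 2 + (c / τ * ‖ι v‖ ^ 2 + τ * ‖A v‖ ^ 2) := by
      field_simp
      ring
    rw [h1]
    have : 0 ≤ c / τ * ‖ι v‖ ^ 2 + τ * ‖A v‖ ^ 2 := by positivity
    linarith
  have hstep : ∀ (g : H) (v : V), ∃ v' : V, ∀ φ,
      inner ℝ (ι v' - ι v) (ι φ) + τ * inner ℝ (A v') (A φ) = τ * inner ℝ g (ι φ) := by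
    intro g v
    let ℓ : V →L[ℝ] ℝ := (innerSL ℝ (ι v + τ • g)).comp ι
    refine ⟨hBc.continuousLinearEquivOfBilin.symm ((InnerProductSpace.toDual ℝ V).symm ℓ),
      fun φ => ?_⟩
    have h1 := hBc.continuousLinearEquivOfBilin_apply
      (hBc.continuousLinearEquivOfBilin.symm ((InnerProductSpace.toDual ℝ V).symm ℓ)) φ
    rw [ContinuousLinearEquiv.apply_symm_apply, InnerProductSpace.toDual_symm_apply, hB] at h1
    have h2 : ℓ φ = inner ℝ (ι v) (ι φ) + τ * inner ℝ g (ι φ) := by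
      rw [← real_inner_smul_left, ← inner_add_left]
      rfl
    rw [inner_sub_left]
    linarith
  choose S hS using hstep
  exact ⟨fun k => Nat.rec u₀ (fun k v => S (f k) v) k, rfl, fun k _ φ => hS _ _ φ⟩

lemma norm_average_sub_le {N : ℕ} (hN : 0 < N) (y : ℕ → H) (x : H) {b : ℝ}
    (h : ∀ i < N, ‖y i - x‖ ≤ b) :
    ‖(N : ℝ)⁻¹ • ∑ i ∈ Finset.range N, y i - x‖ ≤ b := by
  have hN' : (0 : ℝ) < N := by exact_mod_cast hN
  have h1 : (N : ℝ)⁻¹ • ∑ i ∈ Finset.range N, y i - x =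
      (N : ℝ)⁻¹ • ∑ i ∈ Finset.range N, (y i - x) := by
    rw [Finset.sum_sub_distrib, Finset.sum_const, Finset.card_range, smul_sub,
      ← Nat.cast_smul_eq_nsmul ℝ, inv_smul_smul₀ hN'.ne']
  rw [h1, norm_smul, norm_inv, Real.norm_of_nonneg hN'.le, inv_mul_le_iff₀ hN']
  refine (norm_sum_le _ _).trans ?_
  refine (Finset.sum_le_sum fun i hi => h i (Finset.mem_range.mp hi)).trans_eq ?_
  rw [Finset.sum_const, Finset.card_range, nsmul_eq_mul]

lemma sum_range_mul {M : Type*} [AddCommMonoid M] (K N : ℕ) (f : ℕ → M) :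
    ∑ j ∈ Finset.range (K * N), f j =
      ∑ k ∈ Finset.range K, ∑ i ∈ Finset.range N, f (k * N + i) := by
  induction K with
  | zero => simp
  | succ K ih => rw [Finset.sum_range_succ, ← ih, Nat.succ_mul, Finset.sum_range_add]

/-- The distance of two backward Euler solutions, where the time steps of the first are obtained
by dividing those of the second into `N` parts. -/
theorem IsEuler.sum_refinement_le {σ : ℝ} (hσ : 0 < σ) {K N : ℕ} (hN : 0 < N)
    {f g : ℕ → H} {U Z : ℕ → V}
    (hU : IsEuler ι A (N * σ) K f U) (hZ : IsEuler ι A σ (K * N) g Z) (h0 : Z 0 = U 0)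
    (hf : ∀ k < K, ((N : ℝ) * σ) • f k = ∑ i ∈ Finset.range N, σ • g (k * N + i)) :
    σ * ∑ k ∈ Finset.range K, ∑ i ∈ Finset.range N,
        ‖ι (Z (k * N + i + 1)) - ι (U (k + 1))‖ ^ 2 ≤
      4 * (N * σ) ^ 2 * (‖A (U 0)‖ ^ 2 + σ * ∑ j ∈ Finset.range (K * N), ‖g j‖ ^ 2) := by
  have hN' : (0 : ℝ) < N := by exact_mod_cast hN
  -- `v k` is the mean of the fine solution over coarse step `k`, and `D k` its squared variation
  -- there.
  set v : ℕ → V := fun k => (N : ℝ)⁻¹ • ∑ i ∈ Finset.range N, Z (k * N + i + 1) with hv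
  set D : ℕ → ℝ := fun k => ∑ i ∈ Finset.range N,
    ‖ι (Z (k * N + i + 1)) - ι (Z (k * N + i))‖ ^ 2 with hD
  have hD0 : ∀ k, 0 ≤ D k := fun k => Finset.sum_nonneg fun _ _ => sq_nonneg _
  have hosc : ∀ k p q, p ≤ N → q ≤ N →
      ‖ι (Z (k * N + q)) - ι (Z (k * N + p))‖ ≤ Real.sqrt (N * D k) := by
    intro k p q hp hq
    refine Real.le_sqrt_of_sq_le ?_
    exact norm_sub_sq_le_mul_sum (fun j => ι (Z j)) (k * N) N hp hq
  have hav : ∀ k p, p ≤ N → ‖ι (v k) - ι (Z (k * N + p))‖ ^ 2 ≤ N * D k := by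
    intro k p hp
    have h1 : ‖ι (v k) - ι (Z (k * N + p))‖ ≤ Real.sqrt (N * D k) := by
      rw [hv, map_smul, map_sum]
      exact norm_average_sub_le hN _ _ fun i hi => hosc k p (i + 1) hp hi
    calc _ ≤ Real.sqrt (N * D k) ^ 2 := by gcongr
      _ = _ := Real.sq_sqrt (mul_nonneg hN'.le (hD0 k))
  -- Here `ι d - e = ι (v k) - ι (Z (k * N + N))`: the coarse solution has cancelled and only an
  -- oscillation of `Z` within a block remains.
  have hdual := sum_norm_sq_le_of_integrated (ι := ι) (A := A) (τ := N * σ) (by positivity) (K := K)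
    (E := fun m => ∑ j ∈ Finset.range (m * N), σ • Z (j + 1) -
      ∑ k ∈ Finset.range m, ((N : ℝ) * σ) • U (k + 1))
    (d := fun k => v k - U (k + 1)) (e := fun k => ι (Z (k * N + N)) - ι (U (k + 1)))
    (by simp)
    (by
      intro m _
      rw [Finset.sum_range_succ, Nat.succ_mul, Finset.sum_range_add, smul_sub, hv, smul_smul,
        mul_comm (N : ℝ) σ, mul_inv_cancel_right₀ hN'.ne', Finset.smul_sum]
      abel)
    (by
      intro m hm φ
      have h1 := hU.integrated (m + 1) hm φ
      have h2 := hZ.integrated ((m + 1) * N) (Nat.mul_le_mul_right N hm) φ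
      have h3 : ∑ j ∈ Finset.range ((m + 1) * N), σ • g j =
          ∑ k ∈ Finset.range (m + 1), ((N : ℝ) * σ) • f k := by
        rw [sum_range_mul]
        refine Finset.sum_congr rfl fun k hk => (hf k ?_).symm
        have := Finset.mem_range.mp hk
        omega
      rw [h3, ← h1, h0] at h2
      rw [map_sub, inner_sub_left, inner_sub_left, ← Nat.succ_mul]
      rw [inner_sub_left, inner_sub_left] at h2
      linarith)
  have hdual' : ∑ k ∈ Finset.range K, ‖ι (v k) - ι (U (k + 1))‖ ^ 2 ≤
      N * ∑ k ∈ Finset.range K, D k := by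
    simp_rw [map_sub] at hdual
    refine hdual.trans ?_
    rw [Finset.mul_sum]
    refine Finset.sum_le_sum fun k _ => ?_
    rw [sub_sub_sub_cancel_right]
    exact hav k N le_rfl
  have hen := hZ.sum_norm_sub_sq_le hσ
  rw [sum_range_mul, h0] at hen
  set B := ‖A (U 0)‖ ^ 2 + σ * ∑ j ∈ Finset.range (K * N), ‖g j‖ ^ 2 with hB
  -- Split through `v k`. The oscillation and the duality term each contribute `2 N² ∑ D k`, and `∑
  -- D k` is at most `σ * B`; hence the factor `4 (N σ)²`.
  calc σ * ∑ k ∈ Finset.range K, ∑ i ∈ Finset.range N,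
        ‖ι (Z (k * N + i + 1)) - ι (U (k + 1))‖ ^ 2
      ≤ σ * ∑ k ∈ Finset.range K, ∑ _i ∈ Finset.range N,
        (2 * (N * D k) + 2 * ‖ι (v k) - ι (U (k + 1))‖ ^ 2) := by
        refine mul_le_mul_of_nonneg_left (Finset.sum_le_sum fun k _ =>
          Finset.sum_le_sum fun i hi => ?_) hσ.le
        have h1 := hav k (i + 1) (Finset.mem_range.mp hi)
        rw [norm_sub_rev, ← add_assoc] at h1
        have h2 : ‖ι (Z (k * N + i + 1)) - ι (U (k + 1))‖ ≤
            ‖ι (Z (k * N + i + 1)) - ι (v k)‖ + ‖ι (v k) - ι (U (k + 1))‖ :=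
          norm_sub_le_norm_sub_add_norm_sub _ _ _
        calc _ ≤ (‖ι (Z (k * N + i + 1)) - ι (v k)‖ + ‖ι (v k) - ι (U (k + 1))‖) ^ 2 := by gcongr
          _ ≤ 2 * (‖ι (Z (k * N + i + 1)) - ι (v k)‖ ^ 2 + ‖ι (v k) - ι (U (k + 1))‖ ^ 2) :=
            add_sq_le
          _ ≤ _ := by linarith
    _ = σ * (2 * N ^ 2 * ∑ k ∈ Finset.range K, D k +
        2 * N * ∑ k ∈ Finset.range K, ‖ι (v k) - ι (U (k + 1))‖ ^ 2) := by
        congr 1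
        rw [Finset.mul_sum, Finset.mul_sum, ← Finset.sum_add_distrib]
        refine Finset.sum_congr rfl fun k _ => ?_
        rw [Finset.sum_const, Finset.card_range, nsmul_eq_mul]
        ring
    _ ≤ σ * (2 * N ^ 2 * ∑ k ∈ Finset.range K, D k +
        2 * N * (N * ∑ k ∈ Finset.range K, D k)) := by gcongr
    _ = 4 * N ^ 2 * σ * ∑ k ∈ Finset.range K, D k := by ring
    _ ≤ 4 * N ^ 2 * σ * (σ * B) := by gcongr
    _ = _ := by ring

end Abstract

/-! ### Functions of time -/

section Time

/-- A test function of integral zero is the derivative of a test function. -/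
lemma exists_deriv_eq_of_integral_eq_zero {T : ℝ} {ψ : ℝ → ℝ} (hψ : ContDiff ℝ ∞ ψ)
    (hs : HasCompactSupport ψ) (hsub : tsupport ψ ⊆ Set.Ioo 0 T) (h0 : ∫ t, ψ t = 0) :
    ∃ η : ℝ → ℝ, ContDiff ℝ ∞ η ∧ HasCompactSupport η ∧ tsupport η ⊆ Set.Ioo 0 T ∧
      deriv η = ψ := by
  have hint : Integrable ψ := hψ.continuous.integrable_of_hasCompactSupport hs
  -- The endpoints `sInf` and `sSup` of the support lie in it only if it is nonempty.
  rcases (tsupport ψ).eq_empty_or_nonempty with hemp | hne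
  · refine ⟨0, contDiff_const, HasCompactSupport.zero, by simp [tsupport], ?_⟩
    rw [tsupport_eq_empty_iff] at hemp
    rw [hemp]
    exact deriv_const' 0
  -- This primitive vanishes to the left of the support, and to its right because the total integral
  -- is zero.
  set η : ℝ → ℝ := fun t => ∫ r in Set.Iic t, ψ r with hη
  have hderiv : ∀ t, HasDerivAt η (ψ t) t := by
    intro t
    have h1 : HasDerivAt (fun t => ∫ r in (0 : ℝ)..t, ψ r) (ψ t) t :=
      intervalIntegral.integral_hasDerivAt_right (hψ.continuous.intervalIntegrable _ _)
        (hψ.continuous.stronglyMeasurableAtFilter _ _) hψ.continuous.continuousAt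
    have h2 : η = fun t => (∫ r in Set.Iic 0, ψ r) + ∫ r in (0 : ℝ)..t, ψ r := by
      funext t
      rw [← intervalIntegral.integral_Iic_sub_Iic hint.integrableOn hint.integrableOn]
      ring
    rw [h2]
    exact h1.const_add _
  have hd : deriv η = ψ := funext fun t => (hderiv t).deriv
  have ha := hsub (hs.isCompact.sInf_mem hne)
  have hb := hsub (hs.isCompact.sSup_mem hne)
  have hzero : ∀ t ∉ Set.Icc (sInf (tsupport ψ)) (sSup (tsupport ψ)), η t = 0 := by
    intro t ht
    rw [Set.mem_Icc, not_and_or, not_le, not_le] at ht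
    rcases ht with ht | ht
    · refine setIntegral_eq_zero_of_forall_eq_zero fun r hr => ?_
      refine image_eq_zero_of_notMem_tsupport fun hr' => ?_
      exact absurd (csInf_le hs.isCompact.bddBelow hr') (by
        rw [not_le]
        exact lt_of_le_of_lt hr ht)
    · rw [hη, ← h0]
      refine setIntegral_eq_integral_of_forall_compl_eq_zero fun r hr => ?_
      refine image_eq_zero_of_notMem_tsupport fun hr' => ?_
      rw [Set.mem_Iic, not_le] at hr
      exact absurd (le_csSup hs.isCompact.bddAbove hr') (by
        rw [not_le]
        exact ht.trans hr)
  have hsupp : tsupport η ⊆ Set.Icc (sInf (tsupport ψ)) (sSup (tsupport ψ)) := by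
    refine closure_minimal (fun t ht => ?_) isClosed_Icc
    by_contra h
    exact ht (hzero t h)
  refine ⟨η, ?_, HasCompactSupport.intro isCompact_Icc hzero,
    hsupp.trans (Set.Icc_subset_Ioo ha.1 hb.2), hd⟩
  rw [contDiff_infty_iff_deriv, hd]
  exact ⟨fun t => (hderiv t).differentiableAt, hψ⟩

/-- The lemma of du Bois-Reymond. -/
lemma exists_const_of_integral_deriv_mul_eq_zero {T : ℝ} (hT : 0 < T) {z : ℝ → ℝ}
    (hz : ContinuousOn z (Set.Icc 0 T))
    (h : ∀ η : ℝ → ℝ, ContDiff ℝ ∞ η → HasCompactSupport η → tsupport η ⊆ Set.Ioo 0 T →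
      ∫ t in Set.Ioo 0 T, deriv η t * z t = 0) :
    ∃ c, ∀ t ∈ Set.Icc 0 T, z t = c := by
  have hzi : IntegrableOn z (Set.Ioo 0 T) :=
    hz.integrableOn_Icc.mono_set Set.Ioo_subset_Icc_self
  let ρ₀ : ContDiffBump (T / 2) := ⟨T / 8, T / 4, by linarith, by linarith⟩
  set ρ : ℝ → ℝ := ρ₀.normed volume with hρ
  have hρc : ContDiff ℝ ∞ ρ := ρ₀.contDiff_normed
  have hρs : HasCompactSupport ρ := ρ₀.hasCompactSupport_normed
  have hρsub : tsupport ρ ⊆ Set.Ioo 0 T := by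
    rw [hρ, ρ₀.tsupport_normed_eq, Real.closedBall_eq_Icc]
    exact Set.Icc_subset_Ioo (by simp only [ρ₀]; linarith) (by simp only [ρ₀]; linarith)
  have hρ1 : ∫ t, ρ t = 1 := ρ₀.integral_normed
  have hmul : ∀ g : ℝ → ℝ, Continuous g → HasCompactSupport g →
      Integrable (fun t => g t * z t) (volume.restrict (Set.Ioo 0 T)) := by
    intro g hg hgs
    obtain ⟨C, hC⟩ := hgs.exists_bound_of_continuous hg
    exact hzi.bdd_mul hg.aestronglyMeasurable (Eventually.of_forall hC)
  set c := ∫ t in Set.Ioo 0 T, ρ t * z t with hc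
  refine ⟨c, ?_⟩
  -- Subtracting `I * ρ` makes `ψ` mean-free, hence a derivative of a test function; so `z - c` is
  -- orthogonal to all test functions.
  have hψ : ∀ ψ : ℝ → ℝ, ContDiff ℝ ∞ ψ → HasCompactSupport ψ → tsupport ψ ⊆ Set.Ioo 0 T →
      ∫ t, ψ t • (Set.Ioo 0 T).indicator (fun t => z t - c) t = 0 := by
    intro ψ h1 h2 h3
    set I := ∫ t, ψ t with hI
    have hψi : Integrable ψ := h1.continuous.integrable_of_hasCompactSupport h2
    have hρi : Integrable ρ := hρc.continuous.integrable_of_hasCompactSupport hρs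
    have hts : tsupport (fun t => ψ t - I * ρ t) ⊆ tsupport ψ ∪ tsupport ρ := by
      refine (tsupport_sub _ _).trans (Set.union_subset_union_right _ ?_)
      exact tsupport_mul_subset_right
    obtain ⟨η, k1, k2, k3, k4⟩ := exists_deriv_eq_of_integral_eq_zero
      (ψ := fun t => ψ t - I * ρ t) (T := T) (h1.sub (contDiff_const.mul hρc))
      (h2.sub hρs.mul_left) (hts.trans (Set.union_subset h3 hρsub))
      (by rw [integral_sub hψi (hρi.const_mul I), integral_const_mul, hρ1, mul_one, sub_self])
    have h4 := h η k1 k2 k3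
    rw [k4] at h4
    have h5 : ∀ t, (ψ t - I * ρ t) * z t = ψ t * z t - I * (ρ t * z t) := fun t => by ring
    simp_rw [h5] at h4
    rw [integral_sub (hmul ψ h1.continuous h2) ((hmul ρ hρc.continuous hρs).const_mul I),
      integral_const_mul] at h4
    have h6 : I = ∫ t in Set.Ioo 0 T, ψ t :=
      (setIntegral_eq_integral_of_forall_compl_eq_zero fun t ht =>
        image_eq_zero_of_notMem_tsupport fun h => ht (h3 h)).symm
    have h7 : (fun t => ψ t • (Set.Ioo 0 T).indicator (fun t => z t - c) t) =
        (Set.Ioo 0 T).indicator (fun t => ψ t * z t - ψ t * c) := by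
      funext t
      by_cases ht : t ∈ Set.Ioo 0 T
      · rw [Set.indicator_of_mem ht, Set.indicator_of_mem ht, smul_eq_mul, mul_sub]
      · rw [Set.indicator_of_notMem ht, Set.indicator_of_notMem ht, smul_zero]
    rw [h7, integral_indicator measurableSet_Ioo,
      integral_sub (hmul ψ h1.continuous h2) (hψi.integrableOn.mul_const c), integral_mul_const,
      ← h6]
    exact h4
  have hloc : LocallyIntegrableOn ((Set.Ioo 0 T).indicator fun t => z t - c) (Set.Ioo 0 T) := by
    refine IntegrableOn.locallyIntegrableOn ?_
    rw [integrableOn_indicator_iff measurableSet_Ioo, Set.inter_self]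
    exact hzi.sub (integrableOn_const (by simp))
  have hae := isOpen_Ioo.ae_eq_zero_of_integral_contDiff_smul_eq_zero hloc hψ
  have hae' : z =ᵐ[volume.restrict (Set.Icc 0 T)] fun _ => c := by
    rw [← restrict_Ioo_eq_restrict_Icc, EventuallyEq, ae_restrict_iff' measurableSet_Ioo]
    filter_upwards [hae] with t ht htm
    have := ht htm
    rw [Set.indicator_of_mem htm] at this
    linarith
  exact Measure.eqOn_Icc_of_ae_eq volume hT.ne hae' hz continuousOn_const

/-- A continuous function on `[0,T]` with integrable weak derivative `g` is a primitive of `g`. -/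
theorem sub_eq_integral_of_weak_deriv {T : ℝ} (hT : 0 < T) {y g : ℝ → ℝ}
    (hy : ContinuousOn y (Set.Icc 0 T)) (hg : IntervalIntegrable g volume 0 T)
    (h : ∀ η : ℝ → ℝ, ContDiff ℝ ∞ η → HasCompactSupport η → tsupport η ⊆ Set.Ioo 0 T →
      ∫ t in Set.Ioo 0 T, deriv η t * y t = -∫ t in Set.Ioo 0 T, η t * g t) :
    ∀ t ∈ Set.Icc 0 T, y t - y 0 = ∫ r in (0 : ℝ)..t, g r := by
  set G : ℝ → ℝ := fun t => ∫ r in (0 : ℝ)..t, g r with hG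
  have hGac : AbsolutelyContinuousOnInterval G 0 T :=
    hg.absolutelyContinuousOnInterval_intervalIntegral Set.left_mem_uIcc
  have hGc : ContinuousOn G (Set.Icc 0 T) := by
    have := hGac.continuousOn
    rwa [Set.uIcc_of_le hT.le] at this
  -- `y - G` has zero weak derivative. As `g` is only integrable, integration by parts uses the
  -- absolute continuity of `G` and `G' = g` a.e.
  obtain ⟨c, hc⟩ := exists_const_of_integral_deriv_mul_eq_zero hT (z := fun t => y t - G t)
    (hy.sub hGc) (by
      intro η h1 h2 h3
      have hη : AbsolutelyContinuousOnInterval η 0 T :=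
        (h1.of_le (by exact_mod_cast le_top)).contDiffOn.absolutelyContinuousOnInterval
      have hη0 : η 0 = 0 := image_eq_zero_of_notMem_tsupport fun h => (h3 h).1.false
      have hηT : η T = 0 := image_eq_zero_of_notMem_tsupport fun h => (h3 h).2.false
      have hibp := hη.integral_mul_deriv_eq_deriv_mul hGac
      rw [hη0, hηT, zero_mul, zero_mul, sub_self, zero_sub] at hibp
      have hGd : ∫ t in (0 : ℝ)..T, η t * deriv G t = ∫ t in (0 : ℝ)..T, η t * g t := by
        refine intervalIntegral.integral_congr_ae ?_
        filter_upwards [hg.ae_hasDerivAt_integral] with t ht htm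
        rw [(ht (Set.uIoc_subset_uIcc htm) 0 Set.left_mem_uIcc).deriv]
      have hconv : ∀ F : ℝ → ℝ, ∫ t in Set.Ioo 0 T, F t = ∫ t in (0 : ℝ)..T, F t := fun F => by
        rw [intervalIntegral.integral_of_le hT.le, integral_Ioc_eq_integral_Ioo]
      have hη' : Continuous (deriv η) := h1.continuous_deriv (by exact_mod_cast le_top)
      have h4 := h η h1 h2 h3
      rw [hconv, hconv, ← hGd, hibp, neg_neg] at h4
      rw [hconv]
      simp_rw [mul_sub]
      rw [intervalIntegral.integral_sub, h4, sub_self]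
      · refine ContinuousOn.intervalIntegrable ?_
        rw [Set.uIcc_of_le hT.le]
        exact hη'.continuousOn.mul hy
      · refine ContinuousOn.intervalIntegrable ?_
        rw [Set.uIcc_of_le hT.le]
        exact hη'.continuousOn.mul hGc)
  intro t ht
  have h1 := hc t ht
  have h2 := hc 0 (Set.left_mem_Icc.mpr hT.le)
  have h3 : G 0 = 0 := intervalIntegral.integral_same
  linarith

/-- The `L²(0,T)` norm of a function which is bounded on each of `M` time steps. -/
theorem eLpNorm_timeMeasure_le {X : Type*} [NormedAddCommGroup X] {T : ℝ} {M : ℕ} {σ : ℝ}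
    (hσ : 0 < σ) (hM : M * σ = T) {g : ℝ → X} {c : ℕ → ℝ} (hc0 : ∀ k < M, 0 ≤ c k)
    (hc : ∀ k < M, ∀ t ∈ Set.Ioc (k * σ) ((k + 1) * σ), ‖g t‖ ^ 2 ≤ c k) :
    eLpNorm g 2 (timeMeasure T) ≤
      ENNReal.ofReal (Real.sqrt (σ * ∑ k ∈ Finset.range M, c k)) := by
  -- Intervals closed on the right match the ceiling in `piecewiseConst`.
  have hcov : Set.Ioo 0 T ⊆ ⋃ k : Fin M, Set.Ioc (k * σ) ((k + 1) * σ) := by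
    intro t ht
    have ht' : 0 < t / σ := div_pos ht.1 hσ
    have h1 : t / σ ≤ M := by
      rw [div_le_iff₀ hσ, hM]
      exact ht.2.le
    have h2 : 0 < ⌈t / σ⌉₊ := Nat.ceil_pos.mpr ht'
    have h3 : ⌈t / σ⌉₊ ≤ M := Nat.ceil_le.mpr h1
    obtain ⟨k, hk⟩ : ∃ k, ⌈t / σ⌉₊ = k + 1 := ⟨⌈t / σ⌉₊ - 1, by omega⟩
    have h4 := (Nat.ceil_eq_iff (Nat.succ_ne_zero k)).mp hk
    refine Set.mem_iUnion.mpr ⟨⟨k, by omega⟩, ?_, ?_⟩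
    · have := h4.1
      exact (lt_div_iff₀ hσ).mp this
    · have := h4.2
      push_cast at this
      exact (div_le_iff₀ hσ).mp this
  have hlint : ∫⁻ t in Set.Ioo 0 T, ‖g t‖ₑ ^ 2 ≤
      ENNReal.ofReal (σ * ∑ k ∈ Finset.range M, c k) := by
    calc ∫⁻ t in Set.Ioo 0 T, ‖g t‖ₑ ^ 2
        ≤ ∫⁻ t in ⋃ k : Fin M, Set.Ioc (k * σ) ((k + 1) * σ), ‖g t‖ₑ ^ 2 :=
          lintegral_mono_set hcov
      _ ≤ ∑' k : Fin M, ∫⁻ t in Set.Ioc (k * σ) ((k + 1) * σ), ‖g t‖ₑ ^ 2 :=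
          lintegral_iUnion_le _ _
      _ = ∑ k : Fin M, ∫⁻ t in Set.Ioc (k * σ) ((k + 1) * σ), ‖g t‖ₑ ^ 2 := tsum_fintype _
      _ ≤ ∑ k : Fin M, ENNReal.ofReal (c k) * ENNReal.ofReal σ := by
          refine Finset.sum_le_sum fun k _ => ?_
          calc ∫⁻ t in Set.Ioc (k * σ) ((k + 1) * σ), ‖g t‖ₑ ^ 2
              ≤ ∫⁻ _t in Set.Ioc (k * σ) ((k + 1) * σ), ENNReal.ofReal (c k) := by
                refine setLIntegral_mono measurable_const fun t ht => ?_
                rw [← ofReal_norm, ← ENNReal.ofReal_pow (norm_nonneg _)]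
                exact ENNReal.ofReal_le_ofReal (hc k k.2 t ht)
            _ = _ := by
                rw [setLIntegral_const, Real.volume_Ioc]
                congr 2
                ring
      _ = _ := by
          rw [Finset.sum_range, Finset.mul_sum, ENNReal.ofReal_sum_of_nonneg]
          · refine Finset.sum_congr rfl fun k _ => ?_
            rw [ENNReal.ofReal_mul hσ.le, mul_comm]
          · exact fun k _ => mul_nonneg hσ.le (hc0 k k.2)
  rw [eLpNorm_eq_lintegral_rpow_enorm_toReal (by simp) (by simp), Real.sqrt_eq_rpow,
    ← ENNReal.ofReal_rpow_of_nonneg _ (by norm_num)]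
  · simp only [ENNReal.toReal_ofNat, ENNReal.rpow_ofNat]
    exact ENNReal.rpow_le_rpow hlint (by norm_num)
  · exact mul_nonneg hσ.le (Finset.sum_nonneg fun k hk => hc0 k (Finset.mem_range.mp hk))

end Time

/-! ### The error of the backward Euler scheme -/

section Error

lemma ceil_div_eq {σ t : ℝ} (hσ : 0 < σ) {k : ℕ} (ht : t ∈ Set.Ioc (k * σ) ((k + 1) * σ)) :
    ⌈t / σ⌉₊ = k + 1 := by
  rw [Nat.ceil_eq_iff (Nat.succ_ne_zero k)]
  refine ⟨(lt_div_iff₀ hσ).mpr ht.1, (div_le_iff₀ hσ).mpr ?_⟩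
  push_cast
  exact ht.2

lemma intervalIntegrable_of_le {X : Type*} [NormedAddCommGroup X] {f : ℝ → X} {T a b : ℝ}
    (hf : IntervalIntegrable f volume 0 T) (ha : 0 ≤ a) (hab : a ≤ b) (hb : b ≤ T) :
    IntervalIntegrable f volume a b := by
  refine hf.mono_set ?_
  rw [Set.uIcc_of_le hab, Set.uIcc_of_le (ha.trans (hab.trans hb))]
  exact Set.Icc_subset_Icc ha hb

/-- The average of `f` over the time step number `k + 1`. -/
def stepAverage {X : Type*} [NormedAddCommGroup X] [NormedSpace ℝ X] (τ : ℝ) (f : ℝ → X) (k : ℕ) :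
    X :=
  τ⁻¹ • ∫ t in (k * τ)..((k + 1) * τ), f t

/-! ### Averages over time steps -/

section StepAverage

variable {X : Type*} [NormedAddCommGroup X] [NormedSpace ℝ X] {f : ℝ → X} {σ T : ℝ} {M : ℕ}

lemma step_bounds (hσ : 0 < σ) (hM : M * σ = T) {k : ℕ} (hk : k < M) :
    0 ≤ k * σ ∧ k * σ ≤ (k + 1) * σ ∧ (k + 1) * σ ≤ T := by
  have h : ((k : ℝ) + 1) ≤ M := by exact_mod_cast hk
  refine ⟨by positivity, by nlinarith, ?_⟩
  rw [← hM]
  gcongr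

lemma smul_stepAverage (hσ : 0 < σ) (f : ℝ → X) (k : ℕ) :
    σ • stepAverage σ f k = ∫ t in (k * σ)..((k + 1) * σ), f t := by
  rw [stepAverage, smul_inv_smul₀ hσ.ne']

lemma norm_stepAverage_le (hσ : 0 < σ) {b : ℝ} {k : ℕ}
    (h : ∀ᵐ t, t ∈ Set.Ioc (k * σ) ((k + 1) * σ) → ‖f t‖ ≤ b) :
    ‖stepAverage σ f k‖ ≤ b := by
  have hle : (k : ℝ) * σ ≤ (k + 1) * σ := by nlinarith
  have h1 : ‖∫ t in (k * σ)..((k + 1) * σ), f t‖ ≤ b * |(k + 1) * σ - k * σ| := by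
    refine intervalIntegral.norm_integral_le_of_norm_le_const_ae ?_
    rwa [Set.uIoc_of_le hle]
  have h2 : ((k : ℝ) + 1) * σ - k * σ = σ := by ring
  rw [h2, abs_of_pos hσ] at h1
  rw [stepAverage, norm_smul, norm_inv, Real.norm_of_nonneg hσ.le, inv_mul_le_iff₀ hσ, mul_comm σ b]
  exact h1

lemma sum_smul_stepAverage (hσ : 0 < σ) (hf : IntervalIntegrable f volume 0 T) (a N : ℕ)
    (h : (a + N : ℕ) * σ ≤ T) :
    ∑ i ∈ Finset.range N, σ • stepAverage σ f (a + i) = ∫ t in (a * σ)..((a + N : ℕ) * σ), f t := by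
  have h1 := intervalIntegral.sum_integral_adjacent_intervals (f := f) (μ := volume)
    (a := fun i : ℕ => ((a + i : ℕ) : ℝ) * σ) (n := N) (fun i hi => by
      refine intervalIntegrable_of_le hf (by positivity) ?_ ?_
      · gcongr
        omega
      · refine le_trans ?_ h
        gcongr
        omega)
  rw [add_zero] at h1
  rw [← h1]
  refine Finset.sum_congr rfl fun i _ => ?_
  rw [smul_stepAverage hσ]
  congr 1
  push_cast
  ring

lemma sum_smul_stepAverage_zero (hσ : 0 < σ) (hM : M * σ = T) (hf : IntervalIntegrable f volume 0 T)
    {m : ℕ} (hm : m ≤ M) :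
    ∑ k ∈ Finset.range m, σ • stepAverage σ f k = ∫ t in (0 : ℝ)..(m * σ), f t := by
  have h := sum_smul_stepAverage hσ hf 0 m (by
    rw [zero_add, ← hM]
    gcongr)
  simpa using h

end StepAverage

variable {V H W : Type*} [NormedAddCommGroup V] [InnerProductSpace ℝ V] [CompleteSpace V]
  [NormedAddCommGroup H] [InnerProductSpace ℝ H] [CompleteSpace H]
  [NormedAddCommGroup W] [InnerProductSpace ℝ W]
  {ι : V →L[ℝ] H} {A : V →L[ℝ] W}

/-- The error of the backward Euler scheme in terms of the modulus of continuity of the solution. -/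
theorem IsEuler.eLpNorm_sub_le_of_modulus {T σ : ℝ} (hσ : 0 < σ) {M : ℕ}
    (hM : M * σ = T) {u : ℝ → V} {f w : ℝ → H} (hu : IntervalIntegrable u volume 0 T)
    (hf : IntervalIntegrable f volume 0 T) (hw : ContinuousOn w (Set.Icc 0 T))
    (hwu : ∀ᵐ t ∂(timeMeasure T), w t = ι (u t))
    (heq : ∀ t ∈ Set.Icc 0 T, ∀ φ, inner ℝ (w t - w 0) (ι φ) +
      inner ℝ (A (∫ r in (0 : ℝ)..t, u r)) (A φ) = inner ℝ (∫ r in (0 : ℝ)..t, f r) (ι φ))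
    {Z : ℕ → V} (hZ : IsEuler ι A σ M (stepAverage σ f) Z) (hZ0 : ι (Z 0) = w 0) {θ : ℝ}
    (hm : ∀ r ∈ Set.Icc 0 T, ∀ t ∈ Set.Icc 0 T, |r - t| ≤ σ → ‖w r - w t‖ ≤ θ) :
    eLpNorm (fun t => w t - ι (Z ⌈t / σ⌉₊)) 2 (timeMeasure T) ≤
      ENNReal.ofReal (Real.sqrt (4 * T * θ ^ 2)) := by
  -- `w` and `ι u` agree only a.e., which suffices for averages; nodal values must be taken from
  -- `w`.
  have havg : ∀ k < M, ι (stepAverage σ u k) = stepAverage σ w k := by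
    intro k hk
    obtain ⟨h1, h2, h3⟩ := step_bounds hσ hM hk
    rw [stepAverage, stepAverage, map_smul, ← ι.intervalIntegral_comp_comm
      (intervalIntegrable_of_le hu h1 h2 h3)]
    congr 1
    refine (intervalIntegral.integral_congr_ae ?_).symm
    rw [timeMeasure, restrict_Ioo_eq_restrict_Ioc, ae_restrict_iff' measurableSet_Ioc] at hwu
    filter_upwards [hwu] with t ht htm
    rw [Set.uIoc_of_le h2] at htm
    exact ht ⟨h1.trans_lt htm.1, htm.2.trans h3⟩
  have hosc : ∀ k < M, ∀ t ∈ Set.Icc (k * σ) ((k + 1) * σ), ‖stepAverage σ w k - w t‖ ≤ θ := by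
    intro k hk t ht
    obtain ⟨h1, h2, h3⟩ := step_bounds hσ hM hk
    have hwi : IntervalIntegrable w volume (k * σ) ((k + 1) * σ) := by
      refine ContinuousOn.intervalIntegrable (hw.mono ?_)
      rw [Set.uIcc_of_le h2]
      exact Set.Icc_subset_Icc h1 h3
    have h4 : stepAverage σ w k - w t = stepAverage σ (fun r => w r - w t) k := by
      rw [stepAverage, stepAverage, intervalIntegral.integral_sub hwi (by simp),
        intervalIntegral.integral_const, smul_sub, smul_smul,
        (by field_simp; ring : σ⁻¹ * (((k : ℝ) + 1) * σ - k * σ) = 1), one_smul]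
    rw [h4]
    refine norm_stepAverage_le hσ (Eventually.of_forall fun r hr => ?_)
    refine hm r ⟨h1.trans hr.1.le, hr.2.trans h3⟩ t ⟨h1.trans ht.1, ht.2.trans h3⟩ ?_
    rw [abs_le]
    constructor <;> linarith [hr.1, hr.2, ht.1, ht.2]
  -- Now `Z` cancels: `ι d - e` is the average of `w` minus its value at the end of the step, at
  -- most `θ` in norm.
  have hdual := sum_norm_sq_le_of_integrated (ι := ι) (A := A) hσ (K := M)
    (E := fun m => ∑ k ∈ Finset.range m, σ • (stepAverage σ u k - Z (k + 1)))
    (d := fun k => stepAverage σ u k - Z (k + 1))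
    (e := fun k => w ((k + 1 : ℕ) * σ) - ι (Z (k + 1))) (by simp)
    (fun m _ => Finset.sum_range_succ _ _)
    (by
      intro m hm φ
      have h1 := hZ.integrated (m + 1) hm φ
      have hmT : ((m + 1 : ℕ) : ℝ) * σ ∈ Set.Icc 0 T := by
        refine ⟨by positivity, ?_⟩
        rw [← hM]
        gcongr
        exact hm
      have h2 := heq _ hmT φ
      rw [← sum_smul_stepAverage_zero hσ hM hf hm, ← sum_smul_stepAverage_zero hσ hM hu hm, ← h1, hZ0] at h2
      simp_rw [smul_sub]
      rw [Finset.sum_sub_distrib, map_sub, inner_sub_left, inner_sub_left]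
      rw [inner_sub_left, inner_sub_left] at h2
      linarith)
  set d : ℕ → ℝ := fun k => ‖ι (stepAverage σ u k - Z (k + 1))‖ with hd
  have hdual' : ∑ k ∈ Finset.range M, d k ^ 2 ≤ M * θ ^ 2 := by
    refine hdual.trans ?_
    calc _ ≤ ∑ _k ∈ Finset.range M, θ ^ 2 := by
          refine Finset.sum_le_sum fun k hk => ?_
          have hk := Finset.mem_range.mp hk
          rw [map_sub, sub_sub_sub_cancel_right, havg k hk]
          obtain ⟨h1, h2, h3⟩ := step_bounds hσ hM hk
          refine pow_le_pow_left₀ (norm_nonneg _) (hosc k hk _ ?_) 2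
          push_cast
          exact ⟨h2, le_rfl⟩
      _ = _ := by rw [Finset.sum_const, Finset.card_range, nsmul_eq_mul]
  refine (eLpNorm_timeMeasure_le hσ hM (c := fun k => 2 * (θ ^ 2 + d k ^ 2))
    (fun k _ => by positivity) fun k hk t ht => ?_).trans ?_
  · rw [ceil_div_eq hσ ht]
    have h1 := hosc k hk t ⟨ht.1.le, ht.2⟩
    rw [norm_sub_rev] at h1
    have h2 : ‖w t - ι (Z (k + 1))‖ ≤ θ + d k := by
      refine (norm_sub_le_norm_sub_add_norm_sub _ (stepAverage σ w k) _).trans ?_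
      refine add_le_add h1 ?_
      simp only [hd]
      rw [map_sub, havg k hk]
    calc _ ≤ (θ + d k) ^ 2 := by gcongr
      _ ≤ _ := add_sq_le
  · refine ENNReal.ofReal_le_ofReal (Real.sqrt_le_sqrt ?_)
    rw [← Finset.mul_sum, Finset.sum_add_distrib, Finset.sum_const, Finset.card_range,
      nsmul_eq_mul]
    calc σ * (2 * (M * θ ^ 2 + ∑ k ∈ Finset.range M, d k ^ 2))
        ≤ σ * (2 * (M * θ ^ 2 + M * θ ^ 2)) := by gcongr
      _ = 4 * (M * σ) * θ ^ 2 := by ring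
      _ = _ := by rw [hM]

lemma aestronglyMeasurable_step {X : Type*} [NormedAddCommGroup X] (σ : ℝ) (x : ℕ → X)
    (μ : Measure ℝ) : AEStronglyMeasurable (fun t => x ⌈t / σ⌉₊) μ :=
  ((StronglyMeasurable.of_discrete (f := x)).comp_measurable
    (Nat.measurable_ceil.comp (measurable_id.div_const σ))).aestronglyMeasurable

/-- The error of the backward Euler scheme for an abstract parabolic problem. -/
theorem IsEuler.eLpNorm_sub_le {T τ : ℝ} (hT : 0 < T) (hτ : 0 < τ) {K : ℕ}
    (hK : K * τ = T) {c : ℝ} (hc : 0 < c) (hcoer : ∀ v, ‖v‖ ^ 2 ≤ ‖ι v‖ ^ 2 + c * ‖A v‖ ^ 2)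
    {u : ℝ → V} {f w : ℝ → H} (hu : IntervalIntegrable u volume 0 T)
    (hf : IntervalIntegrable f volume 0 T) (hw : ContinuousOn w (Set.Icc 0 T))
    (hwu : ∀ᵐ t ∂(timeMeasure T), w t = ι (u t))
    (heq : ∀ t ∈ Set.Icc 0 T, ∀ φ, inner ℝ (w t - w 0) (ι φ) +
      inner ℝ (A (∫ r in (0 : ℝ)..t, u r)) (A φ) = inner ℝ (∫ r in (0 : ℝ)..t, f r) (ι φ))
    {U : ℕ → V} (hU : IsEuler ι A τ K (stepAverage τ f) U) (hU0 : ι (U 0) = w 0) {F : ℝ}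
    (hF : ∀ᵐ t ∂(timeMeasure T), ‖f t‖ ≤ F) :
    eLpNorm (fun t => w t - ι (U ⌈t / τ⌉₊)) 2 (timeMeasure T) ≤
      ENNReal.ofReal (2 * τ * Real.sqrt (‖A (U 0)‖ ^ 2 + T * F ^ 2)) := by
  -- The continuity of `w` gives no rate, so `N` is chosen after `ε`; the bound for `Z - U` does not
  -- depend on `N`.
  refine ENNReal.le_of_forall_pos_le_add fun ε hε _ => ?_
  have hε' : (0 : ℝ) < ε := hε
  -- Chosen so that `√(4 T θ²) = ε`.
  set θ : ℝ := ε / (2 * Real.sqrt T) with hm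
  have hm0 : 0 < θ := by positivity
  obtain ⟨δ, hδ, hmod⟩ := Metric.uniformContinuousOn_iff.mp
    (isCompact_Icc.uniformContinuousOn_of_continuous hw) θ hm0
  obtain ⟨N, hN⟩ := exists_nat_gt (τ / δ)
  have hN' : (0 : ℝ) < N := (div_pos hτ hδ).trans hN
  have hNpos : 0 < N := by exact_mod_cast hN'
  set σ := τ / N with hσdef
  have hσ : 0 < σ := by positivity
  have hNσ : N * σ = τ := mul_div_cancel₀ _ hN'.ne'
  have hσδ : σ < δ := by
    rw [hσdef, div_lt_iff₀ hN', mul_comm]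
    exact (div_lt_iff₀ hδ).mp hN
  have hM : ((K * N : ℕ) : ℝ) * σ = T := by
    rw [Nat.cast_mul, mul_assoc, hNσ, hK]
  obtain ⟨Z, hZ0, hZ⟩ := IsEuler.exists_solution (ι := ι) (A := A) hσ hc hcoer (K * N)
    (stepAverage σ f) (U 0)
  have h1 := hZ.eLpNorm_sub_le_of_modulus hσ hM hu hf hw hwu heq (by rw [hZ0, hU0]) (θ := θ)
    (fun r hr t ht hrt => by
      rw [← dist_eq_norm]
      exact (hmod r hr t ht (by
        rw [Real.dist_eq]
        exact hrt.trans_lt hσδ)).le)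
  have h1' : Real.sqrt (4 * T * θ ^ 2) = ε := by
    have : 4 * T * θ ^ 2 = (ε : ℝ) ^ 2 := by
      rw [hm, div_pow, mul_pow, Real.sq_sqrt hT.le]
      field_simp
      norm_num
    rw [this, Real.sqrt_sq hε'.le]
  rw [h1', ENNReal.ofReal_coe_nnreal] at h1
  rw [← hNσ] at hU
  have h2 := hU.sum_refinement_le hσ hNpos hZ hZ0 (by
    intro k hk
    have hb : ((k * N + N : ℕ) : ℝ) * σ ≤ T := by
      rw [← hM]
      gcongr
      calc k * N + N = (k + 1) * N := by ring
        _ ≤ K * N := Nat.mul_le_mul_right N hk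
    rw [sum_smul_stepAverage hσ hf _ _ hb, smul_stepAverage (by positivity)]
    congr 1
    · push_cast
      ring
    · push_cast
      ring)
  have hg : ∀ j < K * N, ‖stepAverage σ f j‖ ≤ F := by
    intro j hj
    obtain ⟨k1, k2, k3⟩ := step_bounds hσ hM hj
    refine norm_stepAverage_le hσ ?_
    rw [timeMeasure, restrict_Ioo_eq_restrict_Ioc, ae_restrict_iff' measurableSet_Ioc] at hF
    filter_upwards [hF] with t ht htm
    exact ht ⟨k1.trans_lt htm.1, htm.2.trans k3⟩
  have hB : ‖A (U 0)‖ ^ 2 + σ * ∑ j ∈ Finset.range (K * N), ‖stepAverage σ f j‖ ^ 2 ≤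
      ‖A (U 0)‖ ^ 2 + T * F ^ 2 := by
    have : ∑ j ∈ Finset.range (K * N), ‖stepAverage σ f j‖ ^ 2 ≤ (K * N : ℕ) * F ^ 2 := by
      refine (Finset.sum_le_sum fun j hj => pow_le_pow_left₀ (norm_nonneg _)
        (hg j (Finset.mem_range.mp hj)) 2).trans_eq ?_
      rw [Finset.sum_const, Finset.card_range, nsmul_eq_mul]
    calc _ ≤ ‖A (U 0)‖ ^ 2 + σ * ((K * N : ℕ) * F ^ 2) := by gcongr
      _ = ‖A (U 0)‖ ^ 2 + ((K * N : ℕ) * σ) * F ^ 2 := by ring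
      _ = _ := by rw [hM]
  have h3 : eLpNorm (fun t => ι (Z ⌈t / σ⌉₊) - ι (U ⌈t / τ⌉₊)) 2 (timeMeasure T) ≤
      ENNReal.ofReal (2 * τ * Real.sqrt (‖A (U 0)‖ ^ 2 + T * F ^ 2)) := by
    -- Fine step `j` lies inside coarse step `j / N`, so both functions are constant on it.
    refine (eLpNorm_timeMeasure_le hσ hM
      (c := fun j => ‖ι (Z (j + 1)) - ι (U (j / N + 1))‖ ^ 2)
      (fun j _ => by positivity) fun j hj t ht => ?_).trans ?_
    · have hdm := Nat.div_add_mod' j N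
      have hmod := Nat.mod_lt j hNpos
      rw [ceil_div_eq hσ ht, ceil_div_eq hτ (k := j / N)]
      have e1 : ((j / N : ℕ) : ℝ) * N ≤ j := by exact_mod_cast Nat.div_mul_le_self j N
      have e2 : (j : ℝ) + 1 ≤ ((j / N : ℕ) + 1) * N := by
        have : j + 1 ≤ (j / N + 1) * N := by
          rw [Nat.add_mul, one_mul]
          omega
        exact_mod_cast this
      rw [← hNσ, ← mul_assoc, ← mul_assoc]
      exact ⟨lt_of_le_of_lt (by gcongr) ht.1, ht.2.trans (by gcongr)⟩
    · refine ENNReal.ofReal_le_ofReal ?_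
      rw [sum_range_mul]
      refine Real.sqrt_le_iff.mpr ⟨by positivity, ?_⟩
      rw [mul_pow, Real.sq_sqrt (by positivity), mul_pow]
      calc _ = σ * ∑ k ∈ Finset.range K, ∑ i ∈ Finset.range N,
            ‖ι (Z (k * N + i + 1)) - ι (U (k + 1))‖ ^ 2 := by
            congr 1
            refine Finset.sum_congr rfl fun k _ => Finset.sum_congr rfl fun i hi => ?_
            rw [Nat.mul_comm k N, Nat.mul_add_div hNpos,
              Nat.div_eq_of_lt (Finset.mem_range.mp hi), add_zero]
        _ ≤ _ := h2
        _ ≤ 4 * (N * σ) ^ 2 * (‖A (U 0)‖ ^ 2 + T * F ^ 2) := by gcongr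
        _ = _ := by
          rw [hNσ]
          norm_num
  have hwm : AEStronglyMeasurable w (timeMeasure T) :=
    (hw.aestronglyMeasurable measurableSet_Icc).mono_measure
      (Measure.restrict_mono Set.Ioo_subset_Icc_self le_rfl)
  have hsplit : (fun t => w t - ι (U ⌈t / τ⌉₊)) =
      (fun t => w t - ι (Z ⌈t / σ⌉₊)) + fun t => ι (Z ⌈t / σ⌉₊) - ι (U ⌈t / τ⌉₊) := by
    funext t
    simp
  rw [hsplit, add_comm (ENNReal.ofReal _)]
  refine (eLpNorm_add_le ?_ ?_ (by norm_num)).trans (add_le_add h1 h3)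
  · exact hwm.sub (aestronglyMeasurable_step σ (fun k => ι (Z k)) _)
  · exact (aestronglyMeasurable_step σ (fun k => ι (Z k)) _).sub
      (aestronglyMeasurable_step τ (fun k => ι (U k)) _)

end Error

/-! ### The fractional heat equation -/

section Heat

variable {n : ℕ} {s : ℝ} {Ω : Set (Eucl n)}

instance (T : ℝ) : IsFiniteMeasure (timeMeasure T) :=
  inferInstanceAs (IsFiniteMeasure (volume.restrict (Set.Ioo 0 T)))

lemma intervalIntegrable_of_memLp {X : Type*} [NormedAddCommGroup X] {T : ℝ} (hT : 0 ≤ T)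
    {p : ℝ≥0∞} (hp : 1 ≤ p) {f : ℝ → X} (hf : MemLp f p (timeMeasure T)) :
    IntervalIntegrable f volume 0 T := by
  rw [intervalIntegrable_iff_integrableOn_Ioo_of_le hT]
  exact hf.integrable hp

/-- The time-integrated form of the weak formulation. -/
theorem integrated_weak_equation {T : ℝ} (hT : 0 < T) (hs : 0 ≤ s)
    {W : Type*} [NormedAddCommGroup W] [InnerProductSpace ℝ W] {A : HsTilde n s Ω →L[ℝ] W}
    (hA : ∀ v w : HsTilde n s Ω, energyForm v w = inner ℝ (A v) (A w))
    {f : ℝ → L2On Ω} {u : ℝ → HsTilde n s Ω} {g : ℝ → HsNeg n s Ω} {w : ℝ → L2On Ω}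
    (hf : IntervalIntegrable f volume 0 T) (hu : IntervalIntegrable u volume 0 T)
    (hg : IsWeakTimeDeriv T u g)
    (heq : ∀ᵐ t ∂(timeMeasure T), ∀ φ : HsTilde n s Ω,
      g t φ + energyForm (u t) φ = inner ℝ (f t) (toL2On φ))
    (hw : ContinuousOn w (Set.Icc 0 T)) (hwu : ∀ᵐ t ∂(timeMeasure T), w t = toL2On (u t)) :
    ∀ t ∈ Set.Icc 0 T, ∀ φ : HsTilde n s Ω,
      inner ℝ (w t - w 0) (toL2OnCLM Ω hs φ) + inner ℝ (A (∫ r in (0 : ℝ)..t, u r)) (A φ) =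
        inner ℝ (∫ r in (0 : ℝ)..t, f r) (toL2OnCLM Ω hs φ) := by
  -- Bochner integrals are zero by convention in an incomplete space; completeness lets the integral
  -- of `u` commute with linear maps.
  have := HsTilde.completeSpace (n := n) (Ω := Ω) hs
  intro t ht φ
  let L₁ : L2On Ω →L[ℝ] ℝ := innerSL ℝ (toL2OnCLM Ω hs φ)
  let L₂ : HsTilde n s Ω →L[ℝ] ℝ := (innerSL ℝ (A φ)).comp A
  have hL₁ : ∀ x, L₁ x = inner ℝ x (toL2OnCLM Ω hs φ) := fun x => by
    rw [real_inner_comm]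
    rfl
  have hL₂ : ∀ x, L₂ x = inner ℝ (A x) (A φ) := fun x => real_inner_comm _ _
  have hf' : IntervalIntegrable (fun r => L₁ (f r)) volume 0 T :=
    ⟨L₁.integrable_comp hf.1, L₁.integrable_comp hf.2⟩
  have hu' : IntervalIntegrable (fun r => L₂ (u r)) volume 0 T :=
    ⟨L₂.integrable_comp hu.1, L₂.integrable_comp hu.2⟩
  -- Pairing with the fixed `φ` makes the problem scalar: `⟪w, ι φ⟫` is continuous with an
  -- integrable weak derivative, hence a primitive of it.
  have key := sub_eq_integral_of_weak_deriv hT (y := fun t => L₁ (w t))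
    (g := fun t => L₁ (f t) - L₂ (u t)) (L₁.continuous.comp_continuousOn hw) (hf'.sub hu')
    (fun η h1 h2 h3 => by
      have h4 := hg η h1 h2 h3 φ
      have e1 : ∫ t in Set.Ioo 0 T, deriv η t * L₁ (w t) =
          ∫ t, deriv η t * inner ℝ (toL2On (u t)) (toL2On φ) ∂(timeMeasure T) := by
        refine integral_congr_ae ?_
        filter_upwards [hwu] with r hr
        rw [hL₁, hr]
        rfl
      have e2 : ∫ t in Set.Ioo 0 T, η t * (L₁ (f t) - L₂ (u t)) =
          ∫ t, η t * g t φ ∂(timeMeasure T) := by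
        refine integral_congr_ae ?_
        filter_upwards [heq] with r hr
        have h5 := hr φ
        rw [hA] at h5
        rw [hL₁, hL₂, eq_sub_of_add_eq h5]
        rfl
      rw [e1, e2]
      exact h4) t ht
  have hf't := intervalIntegrable_of_le hf le_rfl ht.1 ht.2
  have hu't := intervalIntegrable_of_le hu le_rfl ht.1 ht.2
  rw [intervalIntegral.integral_sub (intervalIntegrable_of_le hf' le_rfl ht.1 ht.2)
    (intervalIntegrable_of_le hu' le_rfl ht.1 ht.2), L₁.intervalIntegral_comp_comm hf't,
    L₂.intervalIntegral_comp_comm hu't, ← map_sub, hL₁, hL₁, hL₂] at key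
  linarith

lemma sqrt_add_le {κ T S F : ℝ} (hκ : 0 ≤ κ) (hT : 0 ≤ T) (hS : 0 ≤ S) (hF : 0 ≤ F) :
    √(κ * S ^ 2 + T * F ^ 2) ≤ (√κ + √T) * (S + F) := by
  have hκ' := Real.sqrt_nonneg κ
  have hT' := Real.sqrt_nonneg T
  refine Real.sqrt_le_iff.mpr ⟨by positivity, ?_⟩
  have e : κ * S ^ 2 + T * F ^ 2 = (√κ * S) ^ 2 + (√T * F) ^ 2 := by
    rw [mul_pow, mul_pow, Real.sq_sqrt hκ, Real.sq_sqrt hT]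
  have h1 : 0 ≤ √κ * S := by positivity
  have h2 : 0 ≤ √T * F := by positivity
  have h3 : 0 ≤ √κ * F + √T * S := by positivity
  calc κ * S ^ 2 + T * F ^ 2 ≤ (√κ * S + √T * F) ^ 2 := by
        rw [e]
        nlinarith [mul_nonneg h1 h2]
    _ ≤ ((√κ + √T) * (S + F)) ^ 2 := by
        refine pow_le_pow_left₀ (by positivity) ?_ 2
        linarith

end Heat

end FracHeat

end

/-! ### The error estimate for the fractional heat equation -/

theorem theorem5p3 (n : ℕ) (hn : 1 ≤ n) (s : ℝ) (hs0 : 0 < s) (hs1 : s < 1)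
    (Ω : Set (FracHeat.Eucl n)) (hΩo : IsOpen Ω) (hΩb : Bornology.IsBounded Ω)
    (T : ℝ) (hT : 0 < T) :
    ∃ C : ℝ, 0 < C ∧
      ∀ (K : ℕ), 1 ≤ K →
      ∀ (u₀ : FracHeat.HsTilde n s Ω) (f : ℝ → FracHeat.L2On Ω),
        MemLp f ∞ (FracHeat.timeMeasure T) →
      ∀ (u : ℝ → FracHeat.HsTilde n s Ω) (U : ℕ → FracHeat.HsTilde n s Ω),
        FracHeat.IsWeakSolution T f (FracHeat.toL2On u₀) u →
        FracHeat.IsSemidiscreteSolution K (T / K) f u₀ U →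
        eLpNorm (fun t => FracHeat.toL2On (u t) -
            FracHeat.toL2On (FracHeat.piecewiseConst (T / K) U t)) 2 (FracHeat.timeMeasure T) ≤
          ENNReal.ofReal (C * (T / K) *
            (FracHeat.sobolevSeminorm u₀ + (eLpNorm f ∞ (FracHeat.timeMeasure T)).toReal)) := by
  have := FracHeat.HsTilde.completeSpace (n := n) (Ω := Ω) hs0.le
  obtain ⟨D, hDe, hDs, c, hc, hcoer⟩ := FracHeat.exists_gagliardoMap (Ω := Ω) hn hs0 hs1
  have hκ : 0 < FracHeat.fracConst n s / 2 := half_pos (FracHeat.fracConst_pos hs0 hs1)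
  set κ := FracHeat.fracConst n s / 2
  have hsκ : 0 < √κ := Real.sqrt_pos.mpr hκ
  have hsT : 0 < √T := Real.sqrt_pos.mpr hT
  -- The abstract bound is `2 τ √(κ S² + T F²)`, and the root is at most `(√κ + √T)(S + F)`; this
  -- constant does not depend on `Ω`.
  refine ⟨2 * (√κ + √T), by positivity, ?_⟩
  rintro K hK u₀ f hf u U ⟨hu, -, ⟨g, -, hg, heq⟩, w, hw, hwu, hw0⟩ ⟨hU0, hU⟩
  have hK' : (0 : ℝ) < K := by exact_mod_cast hK
  set τ := T / K with hτdef
  have hτ : 0 < τ := by positivity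
  have hKτ : K * τ = T := mul_div_cancel₀ _ hK'.ne'
  -- The factor `√κ` absorbs `C(n,s)/2`, so that the energy form is exactly `⟪A v, A w⟫`; the
  -- coercivity constant becomes `c / κ`.
  set A := √κ • D with hAdef
  have hA : ∀ v w, FracHeat.energyForm v w = inner ℝ (A v) (A w) := by
    intro v w
    rw [hDe, hAdef, smul_apply, smul_apply,
      real_inner_smul_left, real_inner_smul_right, ← mul_assoc, Real.mul_self_sqrt hκ.le]
  have hAn : ∀ v, ‖A v‖ ^ 2 = κ * ‖D v‖ ^ 2 := by
    intro v
    rw [hAdef, smul_apply, norm_smul, mul_pow, Real.norm_of_nonneg hsκ.le,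
      Real.sq_sqrt hκ.le]
  have hui := FracHeat.intervalIntegrable_of_memLp hT.le one_le_two hu
  have hfi := FracHeat.intervalIntegrable_of_memLp hT.le le_top hf
  set F := (eLpNorm f ∞ (FracHeat.timeMeasure T)).toReal with hFdef
  have hF : ∀ᵐ t ∂(FracHeat.timeMeasure T), ‖f t‖ ≤ F := by
    filter_upwards [ae_le_eLpNormEssSup (f := f) (μ := FracHeat.timeMeasure T)] with t ht
    rw [← eLpNorm_exponent_top] at ht
    rw [← toReal_enorm]
    exact ENNReal.toReal_mono hf.2.ne ht
  have hEuler : FracHeat.IsEuler (FracHeat.toL2OnCLM Ω hs0.le) A τ K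
      (FracHeat.stepAverage τ f) U := by
    intro k hk φ
    have h1 := hU k hk φ
    rw [hA, map_smul, map_sub, real_inner_smul_left] at h1
    have h2 : τ * (inner ℝ (FracHeat.timeAverage τ f k) (FracHeat.toL2On φ)) =
      τ * inner ℝ (FracHeat.stepAverage τ f k) (FracHeat.toL2OnCLM Ω hs0.le φ) := rfl
    rw [← h2, ← h1, mul_add, mul_inv_cancel_left₀ hτ.ne']
    rfl
  have hmain := hEuler.eLpNorm_sub_le hT hτ hKτ (c := c / κ) (by positivity)
    (fun v => by
      rw [hAn, ← mul_assoc, div_mul_cancel₀ _ hκ.ne']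
      exact hcoer v)
    hui hfi hw hwu (FracHeat.integrated_weak_equation hT hs0.le hA hfi hui hg heq hw hwu)
    (by
      rw [hU0, hw0]
      rfl) hF
  have hcongr : (fun t => FracHeat.toL2On (u t) -
      FracHeat.toL2On (FracHeat.piecewiseConst τ U t)) =ᵐ[FracHeat.timeMeasure T]
      fun t => w t - FracHeat.toL2OnCLM Ω hs0.le (U ⌈t / τ⌉₊) := by
    filter_upwards [hwu] with t ht
    rw [ht]
    rfl
  rw [eLpNorm_congr_ae hcongr]
  refine hmain.trans (ENNReal.ofReal_le_ofReal ?_)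
  have hS : 0 ≤ FracHeat.sobolevSeminorm u₀ := Real.sqrt_nonneg _
  have hF0 : 0 ≤ F := ENNReal.toReal_nonneg
  rw [hU0, hAn, ← hDs]
  set S := FracHeat.sobolevSeminorm u₀
  have hsqrt := FracHeat.sqrt_add_le hκ.le hT.le hS hF0
  calc 2 * τ * √(κ * S ^ 2 + T * F ^ 2) ≤ 2 * τ * ((√κ + √T) * (S + F)) := by gcongr
    _ = _ := by ring
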